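/- Let $n\ge 3$. Let $R>0$ and let $\gamma:[0,R]\to\mathbb R$ be a $C^2$ convex function such that $\gamma$ is strictly increasing, $\gamma''$ is non-decreasing, and $\gamma(0)=\gamma'(0)=0$ ($\gamma$ may vanish to infinite order at $0$). Let $j\ge 0$ be an integer with $2^{1-j}\le R$, put $\gamma_j(s)=\gamma(2^{-j}s)/\gamma(2^{-j})$ for $1\le s\le 2$, and for $\xi=(\xi',\xi_n)\in\mathbb R^{n-1}\times\mathbb R$ let $$F_j(\xi)=\int_{\{y\in\mathbb R^{n-1}:\,1\le|y|\le2\}}e^{i(\langle y,\xi'\rangle+\xi_n\gamma_j(|y|))}\,e^{i\xi_n/\gamma(2^{-j})}\,dy .$$ Then $$|F_j(\xi)|\le C(1+|\xi|)^{-1}\qquad\text{for all }\xi\in\mathbb R^n,$$ where $C$ depends only on $n$ (and not on $j$, $R$, $\gamma$). Moreover, for every real $K$ there is a constant $C$ depending only on $n$ and $K$ (and not on $j$, $R$, $\gamma$) such that, whenever $\gamma(2^{1-j})\le K$ (for instance $K=1$ if $\gamma\le1$), the function $F_j$ is differentiable and $$|\nabla F_j(\xi)|\le\frac{C}{\gamma(2^{-j})}(1+|\xi|)^{-1}\qquad\text{for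 all }\xi\in\mathbb R^n .$$ -/

import Mathlib

open MeasureTheory Set

noncomputable section

/-- The profile functions `γ` on `[0, R]`: `γ` is `C²` and convex, `γ` is increasing, `γ''` is
increasing (in the wide sense), and `γ(0) = γ'(0) = 0`.  No finite order of vanishing at `0` is
required.  Derivatives at the end points of `[0, R]` are one-sided. -/
structure IsProfile (R : ℝ) (γ : ℝ → ℝ) : Prop where
  contDiffOn : ContDiffOn ℝ 2 γ (Icc 0 R)
  convexOn : ConvexOn ℝ (Icc 0 R) γ
  strictMonoOn : StrictMonoOn γ (Icc 0 R)
  monotoneOn_deriv2 : MonotoneOn (iteratedDerivWithin 2 γ (Icc 0 R)) (Icc 0 R)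
  map_zero : γ 0 = 0
  deriv_zero : derivWithin γ (Icc 0 R) 0 = 0

/-- The dyadic scale `2^{-j}`. -/
def dyadic (j : ℕ) : ℝ := (2 : ℝ) ^ (-(j : ℤ))

/-- `γ_j(s) = γ(2^{-j} s) / γ(2^{-j})`. -/
def rescaled (γ : ℝ → ℝ) (j : ℕ) (s : ℝ) : ℝ := γ (dyadic j * s) / γ (dyadic j)

/-- The first `d` coordinates `ξ'` of a point `ξ = (ξ', ξ_n)` of `ℝ^n`, where `n = d + 1`. -/
def firstCoords {d : ℕ} (ξ : EuclideanSpace ℝ (Fin (d + 1))) : EuclideanSpace ℝ (Fin d) :=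
  WithLp.toLp 2 fun i => ξ i.castSucc

/-- The oscillatory integral
`F_j(ξ) = ∫_{1 ≤ |y| ≤ 2} e^{i(⟨y, ξ'⟩ + ξ_n γ_j(|y|))} e^{i ξ_n / γ(2^{-j})} dy`,
over `y ∈ ℝ^{n-1}`, for `ξ = (ξ', ξ_n) ∈ ℝ^n`, where `n = d + 1`. -/
def annularFT (d : ℕ) (γ : ℝ → ℝ) (j : ℕ) (ξ : EuclideanSpace ℝ (Fin (d + 1))) : ℂ :=
  ∫ y in {y : EuclideanSpace ℝ (Fin d) | 1 ≤ ‖y‖ ∧ ‖y‖ ≤ 2},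
    Complex.exp (Complex.I *
        ((inner ℝ y (firstCoords ξ) + ξ (Fin.last d) * rescaled γ j ‖y‖ : ℝ) : ℂ)) *
      Complex.exp (Complex.I * ((ξ (Fin.last d) / γ (dyadic j) : ℝ) : ℂ))

/-- The gradient `(∂F/∂ξ_1, …, ∂F/∂ξ_n)` of a complex-valued function on `ℝ^n`, as a vector
of `ℂ^n` (with its Hermitian norm). -/
def cgrad {n : ℕ} (F : EuclideanSpace ℝ (Fin n) → ℂ) (ξ : EuclideanSpace ℝ (Fin n)) :
    EuclideanSpace ℂ (Fin n) :=
  WithLp.toLp 2 fun k => fderiv ℝ F ξ (EuclideanSpace.single k (1 : ℝ))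

end

/-! The estimate has two sources of decay, radial and angular, each worth half a power. Rotate `ξ'`
to `A e` with `|e| = 1`, put `B = ξ_n`, and use polar coordinates about `e`. The factor
`e^{iξ_n/γ(2^{-j})}` is constant in `y` and has modulus 1. At angle `θ` there remains the radial
integral over `1 ≤ r ≤ 2` with phase `A cos θ · r + B γ_j(r)`.

Only two uniform facts about `γ_j` are used besides convexity. Since `γ(0) = 0` and `γ'` is
nondecreasing, `γ_j' ≥ 1`. Since `γ'` is convex and `γ'(0) = 0`, `γ_j'(x)(y - x) ≤ 2(γ_j'(y) -
γ_j'(x))` for `x ≤ y`. No upper bound on `γ_j'` is needed, so vanishing to infinite order does no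
harm. If `|B| ≥ 2A`, the phase derivative is at least `|B|/2` and the radial integral alone is
`O(1/|B|)`. Otherwise `A` must supply the decay. When `|cos θ| ≥ 1/2`, a nearly stationary point has
`|B| γ_j'` comparable to `A` or larger, so the phase derivative grows at a rate of order at least
`A`: the nearly stationary set has length `O(A^{-1/2})` and the radial integral is `O(A^{-1/2})`
(`IsConvexPhase.norm_integral_le_sqrt`).

The other half power comes from `θ`. Caps of size `A^{-1/2}` at the poles contribute `O(1/A)`.
Between them one integrates by parts in `θ`, gaining `1/(A sin θ)`; the losses `1/sin` and `∫
1/sin²` are `O(A^{1/2})` and are paid by the radial decay, while near the equator, where that decay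
fails, `sin θ` is bounded below (`norm_integral_radialOsc_le_div`).

A derivative of `F_j` inserts `y_i` or `γ_j(|y|) + 1/γ(2^{-j})`. In the first case a reflection
leaves only the component of `y` along `e`, which changes the angular weight and the power of `r`.
The second is a nonnegative increasing radial amplitude and costs its value at `|y| = 2`, at most
`(K + 1)/γ(2^{-j})`. -/

/-! ### One-dimensional oscillatory integrals with convex phase. -/

/-- The first derivative test for oscillatory integrals: if the phase is convex and its derivative
is at least `δ` in absolute value, then the integral is at most `4 / δ`. -/
theorem norm_integral_exp_le_of_le_abs_deriv {a b δ : ℝ} {φ φ' φ'' : ℝ → ℝ} (hab : a ≤ b)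
    (hδ : 0 < δ) (hφ : ContinuousOn φ (Icc a b)) (hφ' : ContinuousOn φ' (Icc a b))
    (hφ'' : ContinuousOn φ'' (Icc a b)) (h1 : ∀ x ∈ Ioo a b, HasDerivAt φ (φ' x) x)
    (h2 : ∀ x ∈ Ioo a b, HasDerivAt φ' (φ'' x) x) (hpos : ∀ x ∈ Icc a b, 0 ≤ φ'' x)
    (hle : ∀ x ∈ Icc a b, δ ≤ |φ' x|) :
    ‖∫ x in a..b, Complex.exp (Complex.I * (φ x : ℂ))‖ ≤ 4 / δ := by
  have hne : ∀ x ∈ Icc a b, φ' x ≠ 0 := fun x hx => abs_pos.1 (hδ.trans_le (hle x hx))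
  have huI : uIcc a b = Icc a b := uIcc_of_le hab
  have hmin : Ioo (min a b) (max a b) = Ioo a b := by rw [min_eq_left hab, max_eq_right hab]
  have hinv : ∀ x ∈ Icc a b, |(φ' x)⁻¹| ≤ 1 / δ := fun x hx => by
    rw [abs_inv, inv_eq_one_div]; exact one_div_le_one_div_of_le hδ (hle x hx)
  have hu : ContinuousOn (fun x => (φ' x)⁻¹) (Icc a b) := hφ'.inv₀ hne
  have hu' : ContinuousOn (fun x => -φ'' x / φ' x ^ 2) (Icc a b) :=
    hφ''.neg.div (hφ'.pow 2) fun x hx => pow_ne_zero 2 (hne x hx)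
  have hv : ContinuousOn (fun x => Complex.exp (Complex.I * (φ x : ℂ))) (Icc a b) :=
    (continuousOn_const.mul (Complex.continuous_ofReal.comp_continuousOn hφ)).cexp
  have hv' : ContinuousOn (fun x => Complex.I * (φ' x : ℂ) * Complex.exp (Complex.I * (φ x : ℂ)))
      (Icc a b) := (continuousOn_const.mul (Complex.continuous_ofReal.comp_continuousOn hφ')).mul hv
  have hdu : ∀ x ∈ Ioo a b, HasDerivAt (fun x => (φ' x)⁻¹) (-φ'' x / φ' x ^ 2) x := fun x hx =>
    (h2 x hx).inv (hne x (Ioo_subset_Icc_self hx))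
  have hdv : ∀ x ∈ Ioo a b, HasDerivAt (fun x => Complex.exp (Complex.I * (φ x : ℂ)))
      (Complex.I * (φ' x : ℂ) * Complex.exp (Complex.I * (φ x : ℂ))) x := fun x hx => by
    have := (((h1 x hx).ofReal_comp).const_mul Complex.I).cexp
    rwa [mul_comm] at this
  -- Integrate by parts after writing `e^{iφ}` as `(iφ')⁻¹ (e^{iφ})'`.
  have key := intervalIntegral.integral_mul_deriv_eq_deriv_mul_of_hasDerivAt
    (u := fun x => (((φ' x)⁻¹ : ℝ) : ℂ)) (v := fun x => Complex.exp (Complex.I * (φ x : ℂ)))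
    (u' := fun x => ((-φ'' x / φ' x ^ 2 : ℝ) : ℂ))
    (v' := fun x => Complex.I * (φ' x : ℂ) * Complex.exp (Complex.I * (φ x : ℂ))) (a := a) (b := b)
    (huI ▸ Complex.continuous_ofReal.comp_continuousOn hu) (huI ▸ hv)
    (hmin ▸ fun x hx => (hdu x hx).ofReal_comp) (hmin ▸ hdv)
    (ContinuousOn.intervalIntegrable (huI ▸ Complex.continuous_ofReal.comp_continuousOn hu'))
    (ContinuousOn.intervalIntegrable (huI ▸ hv'))
  have hlhs : ∫ x in a..b, (((φ' x)⁻¹ : ℝ) : ℂ) *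
      (Complex.I * (φ' x : ℂ) * Complex.exp (Complex.I * (φ x : ℂ))) =
      Complex.I * ∫ x in a..b, Complex.exp (Complex.I * (φ x : ℂ)) := by
    rw [← intervalIntegral.integral_const_mul]
    refine intervalIntegral.integral_congr fun x hx => ?_
    have : (φ' x : ℂ) ≠ 0 := Complex.ofReal_ne_zero.2 (hne x (huI ▸ hx))
    push_cast
    field_simp
  -- As `φ'' ≥ 0`, the derivative of `1/φ'` has constant sign, so the integral of its absolute value
  -- telescopes to endpoint values.
  have hint : ‖∫ x in a..b, ((-φ'' x / φ' x ^ 2 : ℝ) : ℂ) *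
      Complex.exp (Complex.I * (φ x : ℂ))‖ ≤ 2 / δ := by
    have hFTC : ∫ x in a..b, -φ'' x / φ' x ^ 2 = (φ' b)⁻¹ - (φ' a)⁻¹ :=
      intervalIntegral.integral_eq_sub_of_hasDerivAt_of_le hab hu hdu
        (ContinuousOn.intervalIntegrable (huI ▸ hu'))
    have h3 : ‖∫ x in a..b, ((-φ'' x / φ' x ^ 2 : ℝ) : ℂ) *
        Complex.exp (Complex.I * (φ x : ℂ))‖ ≤ ∫ x in a..b, -(-φ'' x / φ' x ^ 2) := by
      refine intervalIntegral.norm_integral_le_of_norm_le hab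
        (Filter.Eventually.of_forall fun x hx => ?_)
        (ContinuousOn.intervalIntegrable (huI ▸ hu'.neg))
      rw [norm_mul, Complex.norm_exp_I_mul_ofReal, mul_one, Complex.norm_real, Real.norm_eq_abs,
        abs_of_nonpos]
      have := hpos x (Ioc_subset_Icc_self hx)
      rw [neg_div]
      have : 0 ≤ φ'' x / φ' x ^ 2 := by positivity
      linarith
    rw [intervalIntegral.integral_neg, hFTC] at h3
    have ha := abs_le.1 (hinv a (left_mem_Icc.2 hab))
    have hb := abs_le.1 (hinv b (right_mem_Icc.2 hab))
    have : 2 / δ = 1 / δ + 1 / δ := by ring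
    linarith [ha.2, hb.1]
  rw [hlhs] at key
  have hnorm : ∀ x ∈ Icc a b,
      ‖(((φ' x)⁻¹ : ℝ) : ℂ) * Complex.exp (Complex.I * (φ x : ℂ))‖ ≤ 1 / δ := fun x hx => by
    rw [norm_mul, Complex.norm_exp_I_mul_ofReal, mul_one, Complex.norm_real]
    exact hinv x hx
  have h4 := congrArg norm key
  rw [norm_mul, Complex.norm_I, one_mul] at h4
  rw [h4]
  refine (norm_sub_le _ _).trans ?_
  refine (add_le_add (norm_sub_le _ _) hint).trans ?_
  have : 4 / δ = 1 / δ + 1 / δ + 2 / δ := by ring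
  linarith [hnorm a (left_mem_Icc.2 hab), hnorm b (right_mem_Icc.2 hab)]

/-- If the phase is convex and its derivative is at most `δ` in absolute value only on a set of
diameter at most `l`, then the oscillatory integral is at most `l + 8 / δ`. -/
theorem norm_integral_exp_le_of_abs_deriv_le {a b δ l : ℝ} {φ φ' φ'' : ℝ → ℝ} (hab : a ≤ b)
    (hδ : 0 < δ) (hl : 0 ≤ l) (hφ : ContinuousOn φ (Icc a b)) (hφ' : ContinuousOn φ' (Icc a b))
    (hφ'' : ContinuousOn φ'' (Icc a b)) (h1 : ∀ x ∈ Ioo a b, HasDerivAt φ (φ' x) x)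
    (h2 : ∀ x ∈ Ioo a b, HasDerivAt φ' (φ'' x) x) (hpos : ∀ x ∈ Icc a b, 0 ≤ φ'' x)
    (hmono : MonotoneOn φ' (Icc a b))
    (hdiam : ∀ x ∈ Icc a b, ∀ y ∈ Icc a b, |φ' x| ≤ δ → |φ' y| ≤ δ → y - x ≤ l) :
    ‖∫ x in a..b, Complex.exp (Complex.I * (φ x : ℂ))‖ ≤ l + 8 / δ := by
  have h4 : 0 ≤ 4 / δ := by positivity
  have h8 : 8 / δ = 4 / δ + 4 / δ := by ring
  have hsub : ∀ {c e : ℝ}, a ≤ c → c ≤ e → e ≤ b → (∀ x ∈ Icc c e, δ ≤ |φ' x|) →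
      ‖∫ x in c..e, Complex.exp (Complex.I * (φ x : ℂ))‖ ≤ 4 / δ := fun {c e} hc hce he h => by
    have hI : Icc c e ⊆ Icc a b := Icc_subset_Icc hc he
    have hO : Ioo c e ⊆ Ioo a b := Ioo_subset_Ioo hc he
    exact norm_integral_exp_le_of_le_abs_deriv hce hδ (hφ.mono hI) (hφ'.mono hI) (hφ''.mono hI)
      (fun x hx => h1 x (hO hx)) (fun x hx => h2 x (hO hx)) (fun x hx => hpos x (hI hx)) h
  have hma : a ∈ Icc a b := left_mem_Icc.2 hab
  have hmb : b ∈ Icc a b := right_mem_Icc.2 hab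
  by_cases hb : φ' b ≤ -δ
  · have := hsub le_rfl hab le_rfl fun x hx => by
      have := hmono hx hmb hx.2
      rw [abs_of_nonpos (by linarith)]; linarith
    linarith
  by_cases ha : δ ≤ φ' a
  · have := hsub le_rfl hab le_rfl fun x hx => by
      have := hmono hma hx hx.1
      rw [abs_of_nonneg (by linarith)]; linarith
    linarith
  push Not at ha hb
  -- The points `c` and `e` bracket the part where `|φ'| ≤ δ`. Each is an endpoint or a solution of
  -- `φ' = ∓δ`, so both satisfy `|φ'| ≤ δ` and the diameter hypothesis bounds `e - c`. The two outer
  -- pieces cost `4 / δ` each.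
  have hc1 : ∃ c ∈ Icc a b, -δ ≤ φ' c ∧ φ' c ≤ δ ∧
      ‖∫ x in a..c, Complex.exp (Complex.I * (φ x : ℂ))‖ ≤ 4 / δ := by
    by_cases h : -δ ≤ φ' a
    · exact ⟨a, hma, h, ha.le, by simpa using h4⟩
    · push Not at h
      obtain ⟨c, hc, hce⟩ := intermediate_value_Icc hab hφ' ⟨h.le, hb.le⟩
      refine ⟨c, hc, hce.ge, by linarith, hsub le_rfl hc.1 hc.2 fun x hx => ?_⟩
      have := hmono ⟨hx.1, hx.2.trans hc.2⟩ hc hx.2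
      rw [abs_of_nonpos (by linarith)]; linarith
  obtain ⟨c, hc, hcl, hcu, hci⟩ := hc1
  have hc2 : ∃ e ∈ Icc c b, -δ ≤ φ' e ∧ φ' e ≤ δ ∧
      ‖∫ x in e..b, Complex.exp (Complex.I * (φ x : ℂ))‖ ≤ 4 / δ := by
    by_cases h : φ' b ≤ δ
    · exact ⟨b, right_mem_Icc.2 hc.2, hb.le, h, by simpa using h4⟩
    · push Not at h
      obtain ⟨e, he, hee⟩ := intermediate_value_Icc hc.2
        (hφ'.mono (Icc_subset_Icc_left hc.1)) ⟨hcu, h.le⟩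
      refine ⟨e, he, by linarith, hee.le, hsub (hc.1.trans he.1) he.2 le_rfl fun x hx => ?_⟩
      have := hmono ⟨hc.1.trans he.1, he.2⟩ ⟨(hc.1.trans he.1).trans hx.1, hx.2⟩ hx.1
      rw [abs_of_nonneg (by linarith)]; linarith
  obtain ⟨e, he, hel, heu, hei⟩ := hc2
  have hmid : ‖∫ x in c..e, Complex.exp (Complex.I * (φ x : ℂ))‖ ≤ l := by
    have := intervalIntegral.norm_integral_le_of_norm_le_const (a := c) (b := e) (C := 1)
      (f := fun x => Complex.exp (Complex.I * (φ x : ℂ)))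
      fun x _ => (Complex.norm_exp_I_mul_ofReal _).le
    rw [one_mul, abs_of_nonneg (by linarith [he.1])] at this
    exact this.trans (hdiam c hc e ⟨hc.1.trans he.1, he.2⟩ (abs_le.2 ⟨hcl, hcu⟩)
      (abs_le.2 ⟨hel, heu⟩))
  have hv : ContinuousOn (fun x => Complex.exp (Complex.I * (φ x : ℂ))) (Icc a b) :=
    (continuousOn_const.mul (Complex.continuous_ofReal.comp_continuousOn hφ)).cexp
  have hii : ∀ {s t : ℝ}, a ≤ s → s ≤ t → t ≤ b → IntervalIntegrable
      (fun x => Complex.exp (Complex.I * (φ x : ℂ))) volume s t := fun hs hst ht =>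
    ContinuousOn.intervalIntegrable (by rw [uIcc_of_le hst]; exact hv.mono (Icc_subset_Icc hs ht))
  rw [← intervalIntegral.integral_add_adjacent_intervals
      (hii le_rfl (hc.1.trans he.1) he.2) (hii (hc.1.trans he.1) he.2 le_rfl),
    ← intervalIntegral.integral_add_adjacent_intervals
      (hii le_rfl hc.1 hc.2) (hii hc.1 he.1 he.2)]
  refine (norm_add_le _ _).trans ((add_le_add_left (norm_add_le _ _) _).trans ?_)
  linarith

/-! ### Monotone amplitudes and uniformly convex phases on `[1, 2]`. -/

/-- A nonnegative nondecreasing `C¹` amplitude on `[1, 2]`, with its derivative. -/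
structure IsAmplitude (a a' : ℝ → ℝ) : Prop where
  continuous : Continuous a
  continuousOn_deriv : ContinuousOn a' (Icc 1 2)
  hasDerivAt : ∀ x ∈ Ioo (1 : ℝ) 2, HasDerivAt a (a' x) x
  nonneg : ∀ x ∈ Icc (1 : ℝ) 2, 0 ≤ a x
  deriv_nonneg : ∀ x ∈ Icc (1 : ℝ) 2, 0 ≤ a' x

theorem IsAmplitude.mul_pow {a a' : ℝ → ℝ} (h : IsAmplitude a a') (k : ℕ) :
    IsAmplitude (fun r => a r * r ^ k) fun r => a' r * r ^ k + a r * (k * r ^ (k - 1)) where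
  continuous := h.continuous.mul (continuous_pow k)
  continuousOn_deriv := by
    have := h.continuous.continuousOn (s := Icc 1 2)
    have := h.continuousOn_deriv
    fun_prop
  hasDerivAt x hx := (h.hasDerivAt x hx).mul (hasDerivAt_pow k x)
  nonneg x hx := by
    have := h.nonneg x hx
    have : 0 ≤ x := by linarith [hx.1]
    positivity
  deriv_nonneg x hx := by
    have := h.nonneg x hx
    have := h.deriv_nonneg x hx
    have : 0 ≤ x := by linarith [hx.1]
    positivity

/-- A monotone amplitude costs at most its largest value. -/
theorem IsAmplitude.norm_integral_mul_le {a a' : ℝ → ℝ} (h : IsAmplitude a a') {f : ℝ → ℂ}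
    (hf : Continuous f) {C : ℝ}
    (hC : ∀ c ∈ Icc (1 : ℝ) 2, ‖∫ x in c..2, f x‖ ≤ C) :
    ‖∫ x in (1 : ℝ)..2, (a x : ℂ) * f x‖ ≤ a 2 * C := by
  have h12 : (1 : ℝ) ≤ 2 := one_le_two
  have huI : uIcc (1 : ℝ) 2 = Icc 1 2 := uIcc_of_le h12
  have hmin : Ioo (min (1 : ℝ) 2) (max 1 2) = Ioo 1 2 := by
    rw [min_eq_left h12, max_eq_right h12]
  -- The primitive starts at `2`, so the boundary term there vanishes. The rest is at most `a 1 * C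
  -- + (a 2 - a 1) * C = a 2 * C`.
  have hE : ∀ x, HasDerivAt (fun x => ∫ t in (2 : ℝ)..x, f t) (f x) x := fun x =>
    intervalIntegral.integral_hasDerivAt_right (hf.intervalIntegrable _ _)
      (hf.stronglyMeasurableAtFilter _ _) hf.continuousAt
  have hEc : Continuous fun x => ∫ t in (2 : ℝ)..x, f t :=
    continuous_iff_continuousAt.2 fun x => (hE x).continuousAt
  have hEn : ∀ c ∈ Icc (1 : ℝ) 2, ‖∫ x in (2 : ℝ)..c, f x‖ ≤ C := fun c hc => by
    rw [intervalIntegral.integral_symm, norm_neg]; exact hC c hc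
  have ha'i : IntervalIntegrable a' volume 1 2 :=
    ContinuousOn.intervalIntegrable (huI ▸ h.continuousOn_deriv)
  have key := intervalIntegral.integral_mul_deriv_eq_deriv_mul_of_hasDerivAt
    (u := fun x => (a x : ℂ)) (v := fun x => ∫ t in (2 : ℝ)..x, f t)
    (u' := fun x => (a' x : ℂ)) (v' := f) (a := 1) (b := 2)
    (Complex.continuous_ofReal.comp h.continuous).continuousOn hEc.continuousOn
    (hmin ▸ fun x hx => (h.hasDerivAt x hx).ofReal_comp) (fun x _ => hE x)
    (ContinuousOn.intervalIntegrable
      (huI ▸ Complex.continuous_ofReal.comp_continuousOn h.continuousOn_deriv))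
    (hf.intervalIntegrable _ _)
  have hFTC : ∫ x in (1 : ℝ)..2, a' x = a 2 - a 1 :=
    intervalIntegral.integral_eq_sub_of_hasDerivAt_of_le h12 h.continuous.continuousOn
      h.hasDerivAt ha'i
  have hint : ‖∫ x in (1 : ℝ)..2, (a' x : ℂ) * ∫ t in (2 : ℝ)..x, f t‖ ≤
      ∫ x in (1 : ℝ)..2, a' x * C := by
    refine intervalIntegral.norm_integral_le_of_norm_le h12
      (Filter.Eventually.of_forall fun x hx => ?_) (ha'i.mul_const C)
    have hx' := Ioc_subset_Icc_self hx
    rw [norm_mul, Complex.norm_real, Real.norm_eq_abs, abs_of_nonneg (h.deriv_nonneg x hx')]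
    exact mul_le_mul_of_nonneg_left (hEn x hx') (h.deriv_nonneg x hx')
  rw [intervalIntegral.integral_mul_const, hFTC] at hint
  rw [key, intervalIntegral.integral_same, mul_zero, zero_sub]
  refine (norm_sub_le _ _).trans ?_
  have h1 : ‖-((a 1 : ℂ) * ∫ t in (2 : ℝ)..1, f t)‖ ≤ a 1 * C := by
    have h1m : (1 : ℝ) ∈ Icc (1 : ℝ) 2 := ⟨le_rfl, h12⟩
    rw [norm_neg, norm_mul, Complex.norm_real, Real.norm_eq_abs, abs_of_nonneg (h.nonneg 1 h1m)]
    exact mul_le_mul_of_nonneg_left (hEn 1 h1m) (h.nonneg 1 h1m)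
  linarith

/-- A phase `g` on `[1, 2]` with first two derivatives `p` and `q`, such that `p ≥ 1`, `q ≥ 0`, and
`p` grows at least as fast as a multiple of its own size. -/
structure IsConvexPhase (g p q : ℝ → ℝ) : Prop where
  continuous : Continuous g
  continuousOn_deriv : ContinuousOn p (Icc 1 2)
  continuousOn_deriv2 : ContinuousOn q (Icc 1 2)
  hasDerivAt : ∀ x ∈ Ioo (1 : ℝ) 2, HasDerivAt g (p x) x
  hasDerivAt_deriv : ∀ x ∈ Ioo (1 : ℝ) 2, HasDerivAt p (q x) x
  deriv2_nonneg : ∀ x ∈ Icc (1 : ℝ) 2, 0 ≤ q x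
  one_le_deriv : ∀ x ∈ Icc (1 : ℝ) 2, 1 ≤ p x
  mul_sub_le : ∀ x ∈ Icc (1 : ℝ) 2, ∀ y ∈ Icc (1 : ℝ) 2, x ≤ y → p x * (y - x) ≤ 2 * (p y - p x)

namespace IsConvexPhase

variable {g p q : ℝ → ℝ}

theorem monotoneOn_deriv (h : IsConvexPhase g p q) : MonotoneOn p (Icc 1 2) :=
  fun x hx y hy hxy => by
    have h1 := h.mul_sub_le x hx y hy hxy
    have h2 : 0 ≤ p x * (y - x) :=
      mul_nonneg (zero_le_one.trans (h.one_le_deriv x hx)) (sub_nonneg.2 hxy)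
    linarith

/-- The integral of `e^{i (T r + B g(r))}` over `[c, 2]` when `B ≥ 0` dominates `T`. -/
theorem norm_integral_le_div_of_nonneg (h : IsConvexPhase g p q) {T B c : ℝ} (hB : 0 < B)
    (hT : 2 * |T| ≤ B) (hc : c ∈ Icc (1 : ℝ) 2) :
    ‖∫ r in c..2, Complex.exp (Complex.I * ((T * r + B * g r : ℝ) : ℂ))‖ ≤ 8 / B := by
  have hI : Icc c 2 ⊆ Icc 1 2 := Icc_subset_Icc_left hc.1
  have hO : Ioo c 2 ⊆ Ioo 1 2 := Ioo_subset_Ioo_left hc.1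
  have := norm_integral_exp_le_of_le_abs_deriv (φ := fun r => T * r + B * g r)
    (φ' := fun r => T + B * p r) (φ'' := fun r => B * q r) hc.2 (half_pos hB)
    (by have := h.continuous; fun_prop)
    (continuousOn_const.add (continuousOn_const.mul (h.continuousOn_deriv.mono hI)))
    (continuousOn_const.mul (h.continuousOn_deriv2.mono hI))
    (fun x hx => by
      simpa using ((hasDerivAt_id' x).const_mul T).fun_add ((h.hasDerivAt x (hO hx)).const_mul B))
    (fun x hx => ((h.hasDerivAt_deriv x (hO hx)).const_mul B).const_add T)
    (fun x hx => mul_nonneg hB.le (h.deriv2_nonneg x (hI hx)))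
    -- The derivative is at least `B - |T| ≥ B / 2`, because `p ≥ 1`.
    (fun x hx => by
      have h1 := mul_le_mul_of_nonneg_left (h.one_le_deriv x (hI hx)) hB.le
      have h2 := neg_abs_le T
      rw [abs_of_nonneg (by linarith)]
      linarith)
  refine this.trans (le_of_eq ?_)
  field_simp
  norm_num

/-- The integral of `e^{i (T r + B g(r))}` over `[c, 2]` when `B ≥ 0` is arbitrary. -/
theorem norm_integral_le_sqrt_of_nonneg (h : IsConvexPhase g p q) {T B A c : ℝ} (hB : 0 ≤ B)
    (hA : 1 ≤ A) (hT : A ≤ 2 * |T|) (hc : c ∈ Icc (1 : ℝ) 2) :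
    ‖∫ r in c..2, Complex.exp (Complex.I * ((T * r + B * g r : ℝ) : ℂ))‖ ≤ 36 / √A := by
  have hI : Icc c 2 ⊆ Icc 1 2 := Icc_subset_Icc_left hc.1
  have hO : Ioo c 2 ⊆ Ioo 1 2 := Ioo_subset_Ioo_left hc.1
  have hs : 1 ≤ √A := Real.one_le_sqrt.2 hA
  have hs0 : 0 < √A := by linarith
  have hss : √A * √A = A := Real.mul_self_sqrt (by linarith)
  have hsA : √A ≤ A := by nlinarith
  -- With threshold `√A / 4`, the nearly stationary set costs `4 / √A` and the rest `32 / √A`.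
  have := norm_integral_exp_le_of_abs_deriv_le (φ := fun r => T * r + B * g r)
    (φ' := fun r => T + B * p r) (φ'' := fun r => B * q r) (δ := √A / 4) (l := 4 / √A) hc.2
    (by positivity) (by positivity) (by have := h.continuous; fun_prop)
    (continuousOn_const.add (continuousOn_const.mul (h.continuousOn_deriv.mono hI)))
    (continuousOn_const.mul (h.continuousOn_deriv2.mono hI))
    (fun x hx => by
      simpa using ((hasDerivAt_id' x).const_mul T).fun_add ((h.hasDerivAt x (hO hx)).const_mul B))
    (fun x hx => ((h.hasDerivAt_deriv x (hO hx)).const_mul B).const_add T)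
    (fun x hx => mul_nonneg hB (h.deriv2_nonneg x (hI hx)))
    (fun x hx y hy hxy => add_le_add_right (mul_le_mul_of_nonneg_left
      (h.monotoneOn_deriv (hI hx) (hI hy) hxy) hB) T)
    (fun x hx y hy hx1 hy1 => by
      rcases le_total y x with hyx | hxy
      · have : (0 : ℝ) ≤ 4 / √A := by positivity
        linarith
      have h1 := mul_le_mul_of_nonneg_left (h.mul_sub_le x (hI hx) y (hI hy) hxy) hB
      have hx2 := abs_le.1 hx1
      have hy2 := abs_le.1 hy1
      -- At a nearly stationary point `T` and `B p` almost cancel: `|T| ≥ A / 2` and `|T + B p| ≤ √A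
      -- / 4 ≤ A / 4`. Then `(A / 4)(y - x) ≤ 2B (p y - p x) ≤ √A`.
      have hBp : A / 4 ≤ B * p x := by
        have h0 : 0 ≤ B * p x := mul_nonneg hB (zero_le_one.trans (h.one_le_deriv x (hI hx)))
        rcases abs_cases T with ⟨h3, _⟩ | ⟨h3, _⟩ <;> linarith [hx2.1, hx2.2]
      have h2 : A / 4 * (y - x) ≤ B * p x * (y - x) :=
        mul_le_mul_of_nonneg_right hBp (sub_nonneg.2 hxy)
      have h3 : √A * (√A * (y - x)) ≤ √A * 4 := by
        rw [← mul_assoc, hss]; linarith [hx2.1, hy2.2]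
      rw [le_div_iff₀ hs0, mul_comm]
      exact le_of_mul_le_mul_left h3 hs0)
  refine this.trans (le_of_eq ?_)
  field_simp
  norm_num

/-- Complex conjugation preserves the norm; this reduces `B < 0` to `B > 0`, with `T` replaced by
`-T`. -/
theorem norm_integral_exp_neg (f : ℝ → ℝ) (c e : ℝ) :
    ‖∫ r in c..e, Complex.exp (Complex.I * ((-f r : ℝ) : ℂ))‖ =
      ‖∫ r in c..e, Complex.exp (Complex.I * (f r : ℂ))‖ := by
  rw [← Complex.norm_conj]
  simp only [intervalIntegral, map_sub, ← integral_conj, ← Complex.exp_conj, map_mul, map_neg,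
    Complex.conj_I, Complex.conj_ofReal, Complex.ofReal_neg, mul_neg, neg_mul, neg_neg]

theorem norm_integral_le_div (h : IsConvexPhase g p q) {T B c : ℝ} (hB : 0 < |B|)
    (hT : 2 * |T| ≤ |B|) (hc : c ∈ Icc (1 : ℝ) 2) :
    ‖∫ r in c..2, Complex.exp (Complex.I * ((T * r + B * g r : ℝ) : ℂ))‖ ≤ 8 / |B| := by
  rcases abs_cases B with ⟨h1, h2⟩ | ⟨h1, h2⟩
  · rw [h1] at hB hT ⊢
    exact h.norm_integral_le_div_of_nonneg hB hT hc
  · rw [h1] at hB hT ⊢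
    rw [← norm_integral_exp_neg]
    simpa only [neg_add, neg_mul] using
      h.norm_integral_le_div_of_nonneg (T := -T) hB (by rwa [abs_neg]) hc

theorem norm_integral_le_sqrt (h : IsConvexPhase g p q) {T B A c : ℝ}
    (hA : 1 ≤ A) (hT : A ≤ 2 * |T|) (hc : c ∈ Icc (1 : ℝ) 2) :
    ‖∫ r in c..2, Complex.exp (Complex.I * ((T * r + B * g r : ℝ) : ℂ))‖ ≤ 36 / √A := by
  rcases le_total 0 B with h1 | h1
  · exact h.norm_integral_le_sqrt_of_nonneg h1 hA hT hc
  · rw [← norm_integral_exp_neg]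
    simpa only [neg_add, neg_mul] using
      h.norm_integral_le_sqrt_of_nonneg (T := -T) (neg_nonneg.2 h1) hA (by rwa [abs_neg]) hc

end IsConvexPhase

/-! ### The angular integral: decay in both frequencies. -/

/-- The radial part at the angle `θ` of an oscillatory integral in polar coordinates. -/
noncomputable def radialOsc (a g : ℝ → ℝ) (A B : ℝ) (k : ℕ) (θ : ℝ) : ℂ :=
  ∫ r in (1 : ℝ)..2, ((a r * r ^ k : ℝ) : ℂ) *
    Complex.exp (Complex.I * ((A * Real.cos θ * r + B * g r : ℝ) : ℂ))

/-- Differentiating the phase in `θ` brings down `-A sin θ · r`. Thus the integral with one more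
power of `r` is, up to the factor `-iA sin θ`, an exact `θ`-derivative; the angular integration by
parts rests on this. -/
theorem hasDerivAt_radialOsc {a g : ℝ → ℝ} (ha : Continuous a) (hg : Continuous g) (A B : ℝ)
    (k : ℕ) (θ : ℝ) :
    HasDerivAt (radialOsc a g A B k)
      (-Complex.I * A * Real.sin θ * radialOsc a g A B (k + 1) θ) θ := by
  have hF : ∀ k : ℕ, ∀ θ : ℝ, Continuous fun r : ℝ => ((a r * r ^ k : ℝ) : ℂ) *
      Complex.exp (Complex.I * ((A * Real.cos θ * r + B * g r : ℝ) : ℂ)) := fun k θ => by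
    fun_prop
  have hd := (intervalIntegral.hasDerivAt_integral_of_dominated_loc_of_deriv_le (μ := volume)
    (a := 1) (b := 2) (s := univ) (x₀ := θ)
    (F := fun θ r => ((a r * r ^ k : ℝ) : ℂ) *
      Complex.exp (Complex.I * ((A * Real.cos θ * r + B * g r : ℝ) : ℂ)))
    (F' := fun θ r => -Complex.I * A * Real.sin θ * (((a r * r ^ (k + 1) : ℝ) : ℂ) *
      Complex.exp (Complex.I * ((A * Real.cos θ * r + B * g r : ℝ) : ℂ))))
    (bound := fun r => |A| * |a r * r ^ (k + 1)|) Filter.univ_mem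
    (Filter.Eventually.of_forall fun θ => (hF k θ).aestronglyMeasurable)
    ((hF k θ).intervalIntegrable _ _)
    (continuous_const.mul (hF (k + 1) θ)).aestronglyMeasurable
    (Filter.Eventually.of_forall fun r _ θ _ => by
      simp only [norm_mul, Complex.norm_exp_I_mul_ofReal, mul_one, Complex.norm_real, norm_neg,
        Complex.norm_I, one_mul, Real.norm_eq_abs, ← abs_mul (a r)]
      exact mul_le_mul_of_nonneg_right
        (mul_le_of_le_one_right (abs_nonneg _) (Real.abs_sin_le_one θ)) (abs_nonneg _))
    (Continuous.intervalIntegrable (by fun_prop) _ _)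
    (Filter.Eventually.of_forall fun r _ θ _ => by
      have h1 : HasDerivAt (fun θ : ℝ => A * Real.cos θ * r + B * g r)
          (A * -Real.sin θ * r) θ :=
        (((Real.hasDerivAt_cos θ).const_mul A).mul_const r).add_const _
      have h2 := ((h1.ofReal_comp.const_mul Complex.I).cexp).const_mul ((a r * r ^ k : ℝ) : ℂ)
      refine h2.congr_deriv ?_
      push_cast
      ring)).2
  rw [intervalIntegral.integral_const_mul] at hd
  exact hd

theorem norm_radialOsc_le {a a' g : ℝ → ℝ} (ha : IsAmplitude a a') (hg : Continuous g)
    {A B C : ℝ} (k : ℕ) (θ : ℝ)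
    (hC : ∀ c ∈ Icc (1 : ℝ) 2, ‖∫ r in c..2,
      Complex.exp (Complex.I * ((A * Real.cos θ * r + B * g r : ℝ) : ℂ))‖ ≤ C) :
    ‖radialOsc a g A B k θ‖ ≤ a 2 * 2 ^ k * C :=
  (ha.mul_pow k).norm_integral_mul_le (by fun_prop) hC

theorem norm_radialOsc_le_const {a a' g : ℝ → ℝ} (ha : IsAmplitude a a') (hg : Continuous g)
    (A B : ℝ) (k : ℕ) (θ : ℝ) : ‖radialOsc a g A B k θ‖ ≤ a 2 * 2 ^ k := by
  have := norm_radialOsc_le (A := A) (B := B) (C := 1) ha hg k θ fun c hc => by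
    refine (intervalIntegral.norm_integral_le_of_norm_le_const (C := 1)
      fun x _ => (Complex.norm_exp_I_mul_ofReal _).le).trans ?_
    rw [one_mul, abs_of_nonneg (by linarith [hc.2])]
    linarith [hc.1]
  simpa using this

/-- The primitive is `-cot`. This measures the loss from differentiating `1 / sin θ` outside caps of
size `α` at the poles. -/
theorem integral_one_div_sin_sq {α : ℝ} (h0 : 0 < α) (h1 : α ≤ Real.pi / 2) :
    IntervalIntegrable (fun θ => 1 / Real.sin θ ^ 2) volume α (Real.pi - α) ∧
    ∫ θ in α..(Real.pi - α), 1 / Real.sin θ ^ 2 = 2 * (Real.cos α / Real.sin α) := by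
  have hle : α ≤ Real.pi - α := by linarith
  have hsin : ∀ θ ∈ uIcc α (Real.pi - α), Real.sin θ ≠ 0 := fun θ hθ => by
    rw [uIcc_of_le hle] at hθ
    exact (Real.sin_pos_of_pos_of_lt_pi (h0.trans_le hθ.1) (by linarith [hθ.2])).ne'
  have hi : IntervalIntegrable (fun θ => 1 / Real.sin θ ^ 2) volume α (Real.pi - α) :=
    (continuousOn_const.div (Real.continuous_sin.pow 2).continuousOn
      fun θ hθ => pow_ne_zero 2 (hsin θ hθ)).intervalIntegrable
  refine ⟨hi, ?_⟩
  rw [intervalIntegral.integral_eq_sub_of_hasDerivAt (f := fun θ => -(Real.cos θ / Real.sin θ))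
    (fun θ hθ => ?_) hi]
  · rw [Real.cos_pi_sub, Real.sin_pi_sub]; ring
  · refine (((Real.hasDerivAt_cos θ).div (Real.hasDerivAt_sin θ) (hsin θ hθ)).neg).congr_deriv ?_
    rw [← neg_div]
    congr 1
    linarith [Real.sin_sq_add_cos_sq θ]

/-- Decay of the angular integral in the first frequency `A`. -/
theorem norm_integral_radialOsc_le_div {a a' g p q w w' : ℝ → ℝ} {W : ℝ} (ha : IsAmplitude a a')
    (hg : IsConvexPhase g p q) (hw : ∀ θ, HasDerivAt w (w' θ) θ) (hw'c : Continuous w')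
    (hw1 : ∀ θ, |w θ| ≤ 1) (hw'1 : ∀ θ, |w' θ| ≤ W) {A : ℝ} (hA : 1 ≤ A) (B : ℝ) (k : ℕ) :
    ‖∫ θ in (0 : ℝ)..Real.pi, (w θ : ℂ) * radialOsc a g A B (k + 1) θ‖ ≤
      a 2 * 2 ^ (k + 1) * (368 + 152 * W) / A := by
  set N := a 2 * 2 ^ (k + 1) with hN
  have ha2 : 0 ≤ a 2 := ha.nonneg 2 (right_mem_Icc.2 one_le_two)
  have hN0 : 0 ≤ N := by positivity
  have hW : 0 ≤ W := (abs_nonneg _).trans (hw'1 0)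
  have hs : 1 ≤ √A := Real.one_le_sqrt.2 hA
  have hs0 : 0 < √A := by linarith
  have hss : √A * √A = A := Real.mul_self_sqrt (by linarith)
  -- On caps of this size, length times the radial bound `36 / √A` is already of order `1 / A`.
  set α := 1 / √A with hα
  have hα0 : 0 < α := by positivity
  have hα1 : α ≤ 1 := (div_le_one hs0).2 hs
  have hpi := Real.pi_gt_three
  have hpi4 := Real.pi_le_four
  have hle : α ≤ Real.pi - α := by linarith
  have hKd := fun k θ => hasDerivAt_radialOsc ha.continuous hg.continuous A B k θ
  have hKc : ∀ k, Continuous (radialOsc a g A B k) := fun k =>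
    continuous_iff_continuousAt.2 fun θ => (hKd k θ).continuousAt
  have hwc : Continuous w := continuous_iff_continuousAt.2 fun θ => (hw θ).continuousAt
  -- The integration by parts involves the powers `k` and `k + 1`; `N` serves for both since `r ≤
  -- 2`.
  have hK1 : ∀ j ≤ k + 1, ∀ θ, ‖radialOsc a g A B j θ‖ ≤ N := fun j hj θ =>
    (norm_radialOsc_le_const ha hg.continuous A B j θ).trans (by rw [hN]; gcongr; norm_num)
  have hK2 : ∀ j ≤ k + 1, ∀ θ, 1 / 2 ≤ |Real.cos θ| → ‖radialOsc a g A B j θ‖ ≤ N * (36 / √A) :=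
    fun j hj θ hθ => by
      refine (norm_radialOsc_le ha hg.continuous j θ fun c hc =>
        hg.norm_integral_le_sqrt hA ?_ hc).trans (by rw [hN]; gcongr; norm_num)
      rw [abs_mul, abs_of_pos (by linarith : 0 < A)]
      nlinarith
  have hcos : ∀ θ, 0 ≤ θ → θ ≤ α → 1 / 2 ≤ |Real.cos θ| := fun θ h0 h1 => by
    rw [← Real.cos_pi_div_three]
    exact (Real.cos_le_cos_of_nonneg_of_le_pi h0 (by linarith) (by linarith)).trans (le_abs_self _)
  have hcos' : ∀ θ, Real.pi - α ≤ θ → θ ≤ Real.pi → 1 / 2 ≤ |Real.cos θ| := fun θ h0 h1 => by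
    have := hcos (Real.pi - θ) (by linarith) (by linarith)
    rwa [Real.cos_pi_sub, abs_neg] at this
  have hfc : Continuous fun θ => (w θ : ℂ) * radialOsc a g A B (k + 1) θ := by
    have := hKc (k + 1); fun_prop
  have hwn : ∀ θ, ‖(w θ : ℂ)‖ ≤ 1 := fun θ => by rw [Complex.norm_real]; exact hw1 θ
  have hfn : ∀ θ, 1 / 2 ≤ |Real.cos θ| →
      ‖(w θ : ℂ) * radialOsc a g A B (k + 1) θ‖ ≤ N * (36 / √A) := fun θ hθ => by
    rw [norm_mul]
    exact (mul_le_of_le_one_left (norm_nonneg _) (hwn θ)).trans (hK2 _ le_rfl θ hθ)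
  have hend : N * (36 / √A) * α = 36 * N / A := by
    calc N * (36 / √A) * α = 36 * N / (√A * √A) := by rw [hα]; field_simp
      _ = 36 * N / A := by rw [hss]
  have hI1 : ‖∫ θ in (0 : ℝ)..α, (w θ : ℂ) * radialOsc a g A B (k + 1) θ‖ ≤ 36 * N / A := by
    rw [← hend]
    have := intervalIntegral.norm_integral_le_of_norm_le_const (a := 0) (b := α)
      (f := fun θ => (w θ : ℂ) * radialOsc a g A B (k + 1) θ) (C := N * (36 / √A)) fun θ hθ => by
        rw [uIoc_of_le hα0.le] at hθ
        exact hfn θ (hcos θ hθ.1.le hθ.2)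
    rwa [sub_zero, abs_of_pos hα0] at this
  have hI3 : ‖∫ θ in (Real.pi - α)..Real.pi, (w θ : ℂ) * radialOsc a g A B (k + 1) θ‖ ≤
      36 * N / A := by
    rw [← hend]
    have := intervalIntegral.norm_integral_le_of_norm_le_const (a := Real.pi - α) (b := Real.pi)
      (f := fun θ => (w θ : ℂ) * radialOsc a g A B (k + 1) θ) (C := N * (36 / √A)) fun θ hθ => by
        rw [uIoc_of_le (by linarith)] at hθ
        exact hfn θ (hcos' θ hθ.1.le hθ.2)
    rwa [sub_sub_cancel, abs_of_pos hα0] at this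
  have hsin : ∀ θ ∈ Icc α (Real.pi - α), 0 < Real.sin θ := fun θ hθ =>
    Real.sin_pos_of_pos_of_lt_pi (hα0.trans_le hθ.1) (by linarith [hθ.2])
  have huI : uIcc α (Real.pi - α) = Icc α (Real.pi - α) := uIcc_of_le hle
  have hud : ∀ θ ∈ uIcc α (Real.pi - α), HasDerivAt (fun θ => w θ / Real.sin θ)
      ((w' θ * Real.sin θ - w θ * Real.cos θ) / Real.sin θ ^ 2) θ := fun θ hθ =>
    (hw θ).div (Real.hasDerivAt_sin θ) (hsin θ (huI ▸ hθ)).ne'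
  have hu'c : ContinuousOn (fun θ => (w' θ * Real.sin θ - w θ * Real.cos θ) / Real.sin θ ^ 2)
      (uIcc α (Real.pi - α)) :=
    ContinuousOn.div (by fun_prop) (by fun_prop)
      fun θ hθ => pow_ne_zero 2 (hsin θ (huI ▸ hθ)).ne'
  have hv'c : Continuous fun θ => -Complex.I * A * Real.sin θ * radialOsc a g A B (k + 1) θ := by
    have := hKc (k + 1); fun_prop
  -- Integrate by parts against the exact derivative of `radialOsc a g A B k`, with `w / sin` as the
  -- other factor.
  have key := intervalIntegral.integral_mul_deriv_eq_deriv_mul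
    (u := fun θ => ((w θ / Real.sin θ : ℝ) : ℂ)) (v := radialOsc a g A B k)
    (fun θ hθ => (hud θ hθ).ofReal_comp) (fun θ _ => hKd k θ)
    (Complex.continuous_ofReal.comp_continuousOn hu'c).intervalIntegrable
    (hv'c.intervalIntegrable _ _)
  have hlhs : ∫ θ in α..(Real.pi - α), ((w θ / Real.sin θ : ℝ) : ℂ) *
      (-Complex.I * A * Real.sin θ * radialOsc a g A B (k + 1) θ) =
      (-Complex.I * A) * ∫ θ in α..(Real.pi - α), (w θ : ℂ) * radialOsc a g A B (k + 1) θ := by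
    rw [← intervalIntegral.integral_const_mul]
    refine intervalIntegral.integral_congr fun θ hθ => ?_
    have : (Real.sin θ : ℂ) ≠ 0 := Complex.ofReal_ne_zero.2 (hsin θ (huI ▸ hθ)).ne'
    push_cast at this ⊢
    field_simp
  -- Jordan's inequality `sin α ≥ 2α/π` together with `π ≤ 4`.
  have hsα : 1 / Real.sin α ≤ 2 * √A := by
    have h1 := Real.mul_le_sin hα0.le (by linarith)
    have h2 : 1 / (2 * √A) ≤ Real.sin α := by
      refine le_trans ?_ h1
      rw [hα, div_mul_div_comm, mul_one, div_le_div_iff₀ (by positivity) (by positivity)]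
      nlinarith
    rw [div_le_iff₀ (hsin α (left_mem_Icc.2 hle))]
    rw [div_le_iff₀ (by positivity)] at h2
    linarith
  have hbd : ∀ θ, Real.sin θ = Real.sin α → 1 / 2 ≤ |Real.cos θ| →
      ‖((w θ / Real.sin θ : ℝ) : ℂ) * radialOsc a g A B k θ‖ ≤ 72 * N := fun θ h1 h2 => by
    have hsp := hsin α (left_mem_Icc.2 hle)
    rw [norm_mul, Complex.norm_real, Real.norm_eq_abs, h1, abs_div, abs_of_pos hsp]
    calc |w θ| / Real.sin α * ‖radialOsc a g A B k θ‖
        ≤ (2 * √A) * (N * (36 / √A)) := by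
          refine mul_le_mul (le_trans ?_ hsα) (hK2 k (Nat.le_succ k) θ h2) (norm_nonneg _)
            (by positivity)
          exact div_le_div_of_nonneg_right (hw1 θ) hsp.le
      _ = 72 * N := by field_simp; ring
  obtain ⟨hsi, hsI⟩ := integral_one_div_sin_sq hα0 (by linarith : α ≤ Real.pi / 2)
  have hint : ‖∫ θ in α..(Real.pi - α),
      (((w' θ * Real.sin θ - w θ * Real.cos θ) / Real.sin θ ^ 2 : ℝ) : ℂ) *
        radialOsc a g A B k θ‖ ≤ 152 * ((W + 1) * N) := by
    have h3 : ‖∫ θ in α..(Real.pi - α),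
        (((w' θ * Real.sin θ - w θ * Real.cos θ) / Real.sin θ ^ 2 : ℝ) : ℂ) *
        radialOsc a g A B k θ‖ ≤ ∫ θ in α..(Real.pi - α),
          (W + 1) * N * (36 / √A * (1 / Real.sin θ ^ 2) + 2) := by
      refine intervalIntegral.norm_integral_le_of_norm_le hle
        (Filter.Eventually.of_forall fun θ hθ => ?_)
        (((hsi.const_mul _).add intervalIntegrable_const).const_mul _)
      have hsp := hsin θ (Ioc_subset_Icc_self hθ)
      have hnum : |w' θ * Real.sin θ - w θ * Real.cos θ| ≤ W + 1 := by
        refine (abs_sub _ _).trans (add_le_add ?_ ?_)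
        · rw [abs_mul]
          exact (mul_le_of_le_one_right (abs_nonneg _) (Real.abs_sin_le_one θ)).trans (hw'1 θ)
        · rw [abs_mul]
          exact (mul_le_of_le_one_right (abs_nonneg _) (Real.abs_cos_le_one θ)).trans (hw1 θ)
      rw [norm_mul, Complex.norm_real, Real.norm_eq_abs, abs_div, abs_of_pos (pow_pos hsp 2)]
      -- Where `|cos θ| ≥ 1/2` the radial decay offsets `1 / sin²`; elsewhere `1 / sin² ≤ 2` and the
      -- trivial bound suffices.
      have hmain : 1 / Real.sin θ ^ 2 * ‖radialOsc a g A B k θ‖ ≤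
          N * (36 / √A * (1 / Real.sin θ ^ 2) + 2) := by
        by_cases hc : 1 / 2 ≤ |Real.cos θ|
        · have h5 := mul_le_mul_of_nonneg_left (hK2 k (Nat.le_succ k) θ hc)
            (by positivity : 0 ≤ 1 / Real.sin θ ^ 2)
          linarith
        · have h6 : Real.cos θ ^ 2 ≤ 1 / 4 := by
            rw [← sq_abs]
            push Not at hc
            nlinarith [abs_nonneg (Real.cos θ)]
          have h7 : 1 / Real.sin θ ^ 2 ≤ 2 := by
            rw [div_le_iff₀ (pow_pos hsp 2)]
            linarith [Real.sin_sq_add_cos_sq θ]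
          have h8 := mul_le_mul h7 (hK1 k (Nat.le_succ k) θ) (norm_nonneg _) zero_le_two
          have h9 : 0 ≤ N * (36 / √A * (1 / Real.sin θ ^ 2)) := by positivity
          linarith
      calc |w' θ * Real.sin θ - w θ * Real.cos θ| / Real.sin θ ^ 2 * ‖radialOsc a g A B k θ‖
          = |w' θ * Real.sin θ - w θ * Real.cos θ| *
            (1 / Real.sin θ ^ 2 * ‖radialOsc a g A B k θ‖) := by ring
        _ ≤ (W + 1) * (N * (36 / √A * (1 / Real.sin θ ^ 2) + 2)) :=
          mul_le_mul hnum hmain (by positivity) (by positivity)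
        _ = _ := by ring
    refine h3.trans ?_
    rw [intervalIntegral.integral_const_mul, intervalIntegral.integral_add (hsi.const_mul _)
      intervalIntegrable_const, intervalIntegral.integral_const_mul, hsI,
      intervalIntegral.integral_const, smul_eq_mul]
    have hcot : Real.cos α / Real.sin α ≤ 2 * √A :=
      (div_le_div_of_nonneg_right (Real.cos_le_one α) (hsin α (left_mem_Icc.2 hle)).le).trans hsα
    -- The two parts contribute `144` and `2(π - 2α) ≤ 8`, hence the constant `152`.
    have h10 : 36 / √A * (2 * (Real.cos α / Real.sin α)) ≤ 144 := by
      calc 36 / √A * (2 * (Real.cos α / Real.sin α)) ≤ 36 / √A * (2 * (2 * √A)) := by gcongr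
        _ = 144 := by field_simp; norm_num
    rw [mul_comm 152]
    exact mul_le_mul_of_nonneg_left (by linarith) (by positivity)
  have hI2 : ‖∫ θ in α..(Real.pi - α), (w θ : ℂ) * radialOsc a g A B (k + 1) θ‖ ≤
      (296 + 152 * W) * N / A := by
    rw [hlhs] at key
    have h11 := congrArg norm key
    rw [norm_mul, norm_mul, norm_neg, Complex.norm_I, one_mul, Complex.norm_real,
      Real.norm_eq_abs, abs_of_pos (by linarith : 0 < A)] at h11
    rw [le_div_iff₀ (by linarith), mul_comm, h11]
    refine (norm_sub_le _ _).trans ((add_le_add (norm_sub_le _ _) hint).trans ?_)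
    have h12 := hbd (Real.pi - α) (Real.sin_pi_sub α) (hcos' _ le_rfl (by linarith))
    have h13 := hbd α rfl (hcos α hα0.le le_rfl)
    linarith
  rw [← intervalIntegral.integral_add_adjacent_intervals (hfc.intervalIntegrable 0 (Real.pi - α))
      (hfc.intervalIntegrable _ _),
    ← intervalIntegral.integral_add_adjacent_intervals (hfc.intervalIntegrable 0 α)
      (hfc.intervalIntegrable _ _)]
  refine (norm_add_le _ _).trans ((add_le_add (norm_add_le _ _) hI3).trans ?_)
  have : N * (368 + 152 * W) / A = 36 * N / A + (296 + 152 * W) * N / A + 36 * N / A := by ring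
  linarith

/-- Decay of the angular integral in both frequencies. -/
theorem norm_integral_radialOsc_le {a a' g p q w w' : ℝ → ℝ} {W : ℝ} (ha : IsAmplitude a a')
    (hg : IsConvexPhase g p q) (hw : ∀ θ, HasDerivAt w (w' θ) θ) (hw'c : Continuous w')
    (hw1 : ∀ θ, |w θ| ≤ 1) (hw'1 : ∀ θ, |w' θ| ≤ W) {A : ℝ} (hA : 0 ≤ A) (B : ℝ) (k : ℕ) :
    ‖∫ θ in (0 : ℝ)..Real.pi, (w θ : ℂ) * radialOsc a g A B (k + 1) θ‖ ≤
      2 ^ (k + 1) * (1472 + 608 * W) * a 2 / (1 + A + |B|) := by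
  have ha2 : 0 ≤ a 2 := ha.nonneg 2 (right_mem_Icc.2 one_le_two)
  have hW : 0 ≤ W := (abs_nonneg _).trans (hw'1 0)
  have hpi := Real.pi_gt_three
  have hpi4 := Real.pi_le_four
  have hB := abs_nonneg B
  have hden : 0 < 1 + A + |B| := by positivity
  set N := a 2 * 2 ^ (k + 1) with hN
  have hN0 : 0 ≤ N := by positivity
  have hNW : 0 ≤ N * W := by positivity
  have hgoal : 2 ^ (k + 1) * (1472 + 608 * W) * a 2 = N * (1472 + 608 * W) := by rw [hN]; ring
  rw [hgoal]
  have hconst : ∀ C, (∀ θ, ‖radialOsc a g A B (k + 1) θ‖ ≤ C) →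
      ‖∫ θ in (0 : ℝ)..Real.pi, (w θ : ℂ) * radialOsc a g A B (k + 1) θ‖ ≤ 4 * C := fun C hC => by
    have hC0 : 0 ≤ C := (norm_nonneg _).trans (hC 0)
    have := intervalIntegral.norm_integral_le_of_norm_le_const (a := 0) (b := Real.pi)
      (f := fun θ => (w θ : ℂ) * radialOsc a g A B (k + 1) θ) (C := C) fun θ _ => by
        rw [norm_mul, Complex.norm_real]
        exact (mul_le_of_le_one_left (norm_nonneg _) (hw1 θ)).trans (hC θ)
    rw [sub_zero, abs_of_pos Real.pi_pos] at this
    nlinarith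
  have htriv := hconst N (norm_radialOsc_le_const ha hg.continuous A B (k + 1))
  rw [le_div_iff₀ hden]
  -- If `2A ≤ |B|`, then `2A|cos θ| ≤ |B|` at every angle and radial decay in `B` is enough.
  -- Otherwise `A` dominates. Frequencies below one are covered by the trivial bound.
  by_cases hAB : 2 * A ≤ |B|
  · by_cases hB1 : 1 ≤ |B|
    · have hB0 : 0 < |B| := by linarith
      have h1 := hconst (N * (8 / |B|)) fun θ =>
        norm_radialOsc_le ha hg.continuous (k + 1) θ fun c hc =>
          hg.norm_integral_le_div hB0 (by
            rw [abs_mul, abs_of_nonneg hA]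
            have := mul_le_of_le_one_right hA (Real.abs_cos_le_one θ)
            linarith) hc
      calc _ ≤ 4 * (N * (8 / |B|)) * (3 * |B|) := by
            refine mul_le_mul h1 (by linarith) hden.le (by positivity)
        _ = 96 * N := by field_simp; ring
        _ ≤ _ := by nlinarith
    · have h2 : 1 + A + |B| ≤ 4 := by linarith
      calc _ ≤ 4 * N * 4 := mul_le_mul htriv h2 hden.le (by positivity)
        _ ≤ _ := by nlinarith
  · by_cases hA1 : 1 ≤ A
    · have h1 := norm_integral_radialOsc_le_div ha hg hw hw'c hw1 hw'1 hA1 B k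
      calc _ ≤ N * (368 + 152 * W) / A * (4 * A) :=
            mul_le_mul h1 (by linarith) hden.le (by positivity)
        _ = N * (1472 + 608 * W) := by field_simp; ring
    · have h2 : 1 + A + |B| ≤ 4 := by linarith
      calc _ ≤ 4 * N * 4 := mul_le_mul htriv h2 hden.le (by positivity)
        _ ≤ _ := by nlinarith

/-! ### Polar coordinates about an axis, and reflection symmetry. -/

theorem isCompact_annulus {V : Type*} [NormedAddCommGroup V] [NormedSpace ℝ V]
    [FiniteDimensional ℝ V] : IsCompact {y : V | 1 ≤ ‖y‖ ∧ ‖y‖ ≤ 2} := by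
  have : ProperSpace V := FiniteDimensional.proper_real V
  refine Metric.isCompact_of_isClosed_isBounded
    ((isClosed_le continuous_const continuous_norm).inter
      (isClosed_le continuous_norm continuous_const)) ?_
  exact (Metric.isBounded_closedBall (x := (0 : V)) (r := 2)).subset fun y hy => by
    simpa using hy.2

theorem isCompact_prod_annulus {V : Type*} [NormedAddCommGroup V] [NormedSpace ℝ V]
    [FiniteDimensional ℝ V] :
    IsCompact {p : ℝ × V | 1 ≤ √(p.1 ^ 2 + ‖p.2‖ ^ 2) ∧ √(p.1 ^ 2 + ‖p.2‖ ^ 2) ≤ 2} := by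
  have : ProperSpace V := FiniteDimensional.proper_real V
  have hN : Continuous fun p : ℝ × V => √(p.1 ^ 2 + ‖p.2‖ ^ 2) := by fun_prop
  refine Metric.isCompact_of_isClosed_isBounded
    ((isClosed_le continuous_const hN).inter (isClosed_le hN continuous_const)) ?_
  refine (Metric.isBounded_closedBall (x := (0 : ℝ × V)) (r := 2)).subset fun p hp => ?_
  rw [mem_closedBall_zero_iff, Prod.norm_def, max_le_iff]
  refine ⟨le_trans ?_ hp.2, le_trans ?_ hp.2⟩
  · rw [Real.norm_eq_abs, ← Real.sqrt_sq_eq_abs]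
    exact Real.sqrt_le_sqrt (by nlinarith [sq_nonneg ‖p.2‖])
  · exact Real.le_sqrt_of_sq_le (by nlinarith [sq_nonneg p.1])

/-- Any unit vector of `ℝ^{m+1}` is the first basis vector of an orthogonal splitting. -/
theorem exists_linearIsometryEquiv_prod {m : ℕ} (e : EuclideanSpace ℝ (Fin (m + 1)))
    (he : ‖e‖ = 1) :
    ∃ L : EuclideanSpace ℝ (Fin (m + 1)) ≃ₗᵢ[ℝ] WithLp 2 (ℝ × EuclideanSpace ℝ (Fin m)),
      L e = WithLp.toLp 2 (1, 0) := by
  have hfr : Module.finrank ℝ (WithLp 2 (ℝ × EuclideanSpace ℝ (Fin m))) = m + 1 := by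
    rw [(WithLp.linearEquiv 2 ℝ (ℝ × EuclideanSpace ℝ (Fin m))).finrank_eq]
    simp [add_comm]
  let L₀ : EuclideanSpace ℝ (Fin (m + 1)) ≃ₗᵢ[ℝ] WithLp 2 (ℝ × EuclideanSpace ℝ (Fin m)) :=
    ((stdOrthonormalBasis ℝ (WithLp 2 (ℝ × EuclideanSpace ℝ (Fin m)))).reindex
      (finCongr hfr)).repr.symm
  -- Two vectors of equal norm are exchanged by the reflection in the hyperplane orthogonal to their
  -- difference.
  refine ⟨L₀.trans (Submodule.reflection
    (Submodule.span ℝ {L₀ e - WithLp.toLp 2 ((1 : ℝ), (0 : EuclideanSpace ℝ (Fin m)))})ᗮ), ?_⟩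
  rw [LinearIsometryEquiv.trans_apply]
  refine Submodule.reflection_sub ?_
  rw [L₀.norm_map, he, WithLp.prod_norm_eq_of_L2]
  simp

/-- The surface measure constant `m |B^m|` of the unit sphere of `ℝ^m`. -/
noncomputable def sphereConst (m : ℕ) : ℝ := m * volume.real (Metric.ball (0 : EuclideanSpace ℝ (Fin m)) 1)

/-- An isometry taking `e` to the first axis preserves volume and turns `⟨y, e⟩` into the first
coordinate. -/
theorem setIntegral_annulus_eq_prod {m : ℕ} (e : EuclideanSpace ℝ (Fin (m + 1))) (he : ‖e‖ = 1)
    (f : ℝ → ℝ → ℂ) :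
    ∫ y in {y : EuclideanSpace ℝ (Fin (m + 1)) | 1 ≤ ‖y‖ ∧ ‖y‖ ≤ 2}, f (inner ℝ y e) ‖y‖ =
      ∫ p in {p : ℝ × EuclideanSpace ℝ (Fin m) |
          1 ≤ √(p.1 ^ 2 + ‖p.2‖ ^ 2) ∧ √(p.1 ^ 2 + ‖p.2‖ ^ 2) ≤ 2},
        f p.1 √(p.1 ^ 2 + ‖p.2‖ ^ 2) := by
  obtain ⟨L, hL⟩ := exists_linearIsometryEquiv_prod e he
  have hmp : MeasurePreserving (fun y => WithLp.ofLp (L y)) volume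
      (volume : Measure (ℝ × EuclideanSpace ℝ (Fin m))) :=
    (WithLp.volume_preserving_ofLp ℝ (EuclideanSpace ℝ (Fin m))).comp L.measurePreserving
  have hemb : MeasurableEmbedding (fun y => WithLp.ofLp (L y)) :=
    (MeasurableEquiv.toLp 2 (ℝ × EuclideanSpace ℝ (Fin m))).symm.measurableEmbedding.comp
      L.toHomeomorph.measurableEmbedding
  have hnorm : ∀ y, √((WithLp.ofLp (L y)).1 ^ 2 + ‖(WithLp.ofLp (L y)).2‖ ^ 2) = ‖y‖ := fun y => by
    rw [← L.norm_map y, WithLp.prod_norm_eq_of_L2]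
    simp
  have hin : ∀ y, (WithLp.ofLp (L y)).1 = inner ℝ y e := fun y => by
    rw [← L.inner_map_map y e, hL, WithLp.prod_inner_apply]
    simp
  rw [← hmp.setIntegral_preimage_emb hemb]
  simp only [preimage_ofPred_eq, hnorm]
  simp only [hin]

/-- For a fixed first coordinate the integrand is radial in the other `m` variables, so these reduce
to their norm `s` with weight `s^{m-1}`. For `m ≥ 1` the space `ℝ^m` is nontrivial, as radial
integration requires. -/
theorem setIntegral_prod_annulus_eq {m : ℕ} (hm : 1 ≤ m)
    {f : ℝ → ℝ → ℂ} (hf : Continuous (Function.uncurry f)) :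
    ∫ p in {p : ℝ × EuclideanSpace ℝ (Fin m) |
          1 ≤ √(p.1 ^ 2 + ‖p.2‖ ^ 2) ∧ √(p.1 ^ 2 + ‖p.2‖ ^ 2) ≤ 2},
        f p.1 √(p.1 ^ 2 + ‖p.2‖ ^ 2) =
    (sphereConst m : ℂ) * ∫ p in (univ : Set ℝ) ×ˢ Ioi (0 : ℝ),
      {p : ℝ × ℝ | 1 ≤ √(p.1 ^ 2 + ‖p.2‖ ^ 2) ∧ √(p.1 ^ 2 + ‖p.2‖ ^ 2) ≤ 2}.indicator
        (fun p => ((p.2 ^ (m - 1) : ℝ) : ℂ) * f p.1 √(p.1 ^ 2 + ‖p.2‖ ^ 2)) p := by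
  have : Nonempty (Fin m) := ⟨⟨0, hm⟩⟩
  have hc : ∀ (V : Type) [NormedAddCommGroup V],
      Continuous fun p : ℝ × V => f p.1 √(p.1 ^ 2 + ‖p.2‖ ^ 2) := fun V _ => by
    have : (fun p : ℝ × V => f p.1 √(p.1 ^ 2 + ‖p.2‖ ^ 2)) =
      fun p => Function.uncurry f (p.1, √(p.1 ^ 2 + ‖p.2‖ ^ 2)) := rfl
    rw [this]
    exact hf.comp (by fun_prop)
  rw [← integral_indicator isCompact_prod_annulus.measurableSet,
    Measure.volume_eq_prod ℝ (EuclideanSpace ℝ (Fin m)), Measure.volume_eq_prod ℝ ℝ,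
    integral_prod, setIntegral_prod, ← integral_const_mul, setIntegral_univ]
  · congr 1
    ext t
    have := integral_fun_norm_addHaar (volume : Measure (EuclideanSpace ℝ (Fin m)))
      (fun s => {p : ℝ × ℝ | 1 ≤ √(p.1 ^ 2 + ‖p.2‖ ^ 2) ∧ √(p.1 ^ 2 + ‖p.2‖ ^ 2) ≤ 2}.indicator
        (fun p => f p.1 √(p.1 ^ 2 + ‖p.2‖ ^ 2)) (t, s))
    rw [finrank_euclideanSpace_fin] at this
    refine Eq.trans ?_ (this.trans ?_)
    · congr 1
      ext z
      simp [indicator]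
    · rw [nsmul_eq_mul, Complex.real_smul, ← mul_assoc, sphereConst]
      push_cast
      congr 2
      ext s
      simp [indicator]
  · refine IntegrableOn.mono_set ?_ (subset_univ _)
    rw [integrableOn_univ, integrable_indicator_iff isCompact_prod_annulus.measurableSet]
    exact ContinuousOn.integrableOn_compact isCompact_prod_annulus
      (Continuous.continuousOn ((by fun_prop : Continuous fun p : ℝ × ℝ =>
        ((p.2 ^ (m - 1) : ℝ) : ℂ)).mul (hc ℝ)))
  · rw [integrable_indicator_iff isCompact_prod_annulus.measurableSet]
    exact ContinuousOn.integrableOn_compact isCompact_prod_annulus (hc _).continuousOn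

/-- Planar polar coordinates: the Jacobian `r` times `(r sin θ)^{m-1}` is `sin^{m-1} θ · r^m`, and
the half plane is `0 < θ < π`. -/
theorem setIntegral_halfPlane_eq {m : ℕ} (hm : 1 ≤ m) {f : ℝ → ℝ → ℂ}
    (hf : Continuous (Function.uncurry f)) :
    ∫ p in (univ : Set ℝ) ×ˢ Ioi (0 : ℝ),
      {p : ℝ × ℝ | 1 ≤ √(p.1 ^ 2 + ‖p.2‖ ^ 2) ∧ √(p.1 ^ 2 + ‖p.2‖ ^ 2) ≤ 2}.indicator
        (fun p => ((p.2 ^ (m - 1) : ℝ) : ℂ) * f p.1 √(p.1 ^ 2 + ‖p.2‖ ^ 2)) p =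
    ∫ θ in (0 : ℝ)..Real.pi, ∫ r in (1 : ℝ)..2,
      ((Real.sin θ ^ (m - 1) * r ^ m : ℝ) : ℂ) * f (r * Real.cos θ) r := by
  have hms : MeasurableSet ((univ : Set ℝ) ×ˢ Ioi (0 : ℝ)) :=
    MeasurableSet.univ.prod measurableSet_Ioi
  rw [← integral_indicator hms, ← integral_comp_polarCoord_symm,
    intervalIntegral.integral_of_le Real.pi_pos.le]
  simp only [intervalIntegral.integral_of_le one_le_two]
  have hcont : Continuous fun p : ℝ × ℝ =>
      ((Real.sin p.2 ^ (m - 1) * p.1 ^ m : ℝ) : ℂ) * f (p.1 * Real.cos p.2) p.1 := by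
    have : Continuous fun p : ℝ × ℝ => Function.uncurry f (p.1 * Real.cos p.2, p.1) :=
      hf.comp (by fun_prop)
    exact (by fun_prop : Continuous fun p : ℝ × ℝ =>
      ((Real.sin p.2 ^ (m - 1) * p.1 ^ m : ℝ) : ℂ)).mul this
  have hion : IntegrableOn (fun p : ℝ × ℝ =>
      ((Real.sin p.2 ^ (m - 1) * p.1 ^ m : ℝ) : ℂ) * f (p.1 * Real.cos p.2) p.1)
      (Ioc 1 2 ×ˢ Ioc 0 Real.pi) (volume.prod volume) :=
    (hcont.continuousOn.integrableOn_compact (isCompact_Icc.prod isCompact_Icc)).mono_set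
      (prod_mono Ioc_subset_Icc_self Ioc_subset_Icc_self)
  have hswap : ∫ θ in Ioc (0 : ℝ) Real.pi, ∫ r in Ioc (1 : ℝ) 2,
      ((Real.sin θ ^ (m - 1) * r ^ m : ℝ) : ℂ) * f (r * Real.cos θ) r =
      ∫ r in Ioc (1 : ℝ) 2, ∫ θ in Ioc (0 : ℝ) Real.pi,
      ((Real.sin θ ^ (m - 1) * r ^ m : ℝ) : ℂ) * f (r * Real.cos θ) r := by
    symm
    refine integral_integral_swap ?_
    rw [Measure.prod_restrict]
    exact hion
  rw [hswap, ← setIntegral_prod _ hion, ← Measure.volume_eq_prod,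
    ← integral_indicator polarCoord.open_target.measurableSet,
    ← integral_indicator (measurableSet_Ioc.prod measurableSet_Ioc)]
  -- The closed annulus and the open chart differ from the half-open rectangle only on the null
  -- lines `r = 1` and `θ = π`.
  have hae : ∀ᵐ p : ℝ × ℝ, p.1 ≠ 1 ∧ p.2 ≠ Real.pi := by
    rw [Measure.volume_eq_prod]
    have h1 : ∀ᵐ p : ℝ × ℝ ∂(volume.prod volume), p.1 ≠ 1 :=
      Measure.quasiMeasurePreserving_fst.ae (Measure.ae_ne volume 1)
    have h2 : ∀ᵐ p : ℝ × ℝ ∂(volume.prod volume), p.2 ≠ Real.pi :=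
      Measure.quasiMeasurePreserving_snd.ae (Measure.ae_ne volume Real.pi)
    exact h1.and h2
  refine integral_congr_ae (hae.mono fun p hp => ?_)
  obtain ⟨r, θ⟩ := p
  obtain ⟨hr1, hθ1⟩ := hp
  simp only at hr1 hθ1
  by_cases ht : (r, θ) ∈ polarCoord.target
  · rw [indicator_of_mem ht]
    obtain ⟨hr, hθl, hθu⟩ := ht
    rw [mem_Ioi] at hr
    have hN : √((r * Real.cos θ) ^ 2 + ‖r * Real.sin θ‖ ^ 2) = r := by
      rw [Real.norm_eq_abs, sq_abs, mul_pow, mul_pow, ← mul_add, Real.cos_sq_add_sin_sq, mul_one,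
        Real.sqrt_sq hr.le]
    simp only [polarCoord_symm_apply, indicator, mem_prod, mem_univ, true_and, mem_Ioi,
      mem_ofPred_eq, hN, mem_Ioc]
    by_cases hθ : 0 < θ
    · have hs : 0 < r * Real.sin θ := mul_pos hr (Real.sin_pos_of_pos_of_lt_pi hθ hθu)
      have hiff : (1 < r ∧ r ≤ 2) ∧ 0 < θ ∧ θ ≤ Real.pi ↔ 1 ≤ r ∧ r ≤ 2 :=
        ⟨fun h => ⟨h.1.1.le, h.1.2⟩, fun h => ⟨⟨lt_of_le_of_ne h.1 hr1.symm, h.2⟩, hθ, hθu.le⟩⟩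
      simp only [hs, if_true, hiff]
      split_ifs
      · obtain ⟨k, rfl⟩ := Nat.exists_eq_add_of_le' hm
        rw [Complex.real_smul, add_tsub_cancel_right]
        push_cast
        ring
      · simp
    · have hs : ¬ 0 < r * Real.sin θ := by
        have := Real.sin_nonpos_of_nonpos_of_neg_pi_le (not_lt.1 hθ) hθl.le
        nlinarith
      simp [hs, hθ]
  · rw [indicator_of_notMem ht, indicator_of_notMem]
    rintro ⟨h1, h2⟩
    refine ht ⟨zero_lt_one.trans h1.1, ?_, lt_of_le_of_ne h2.2 hθ1⟩
    linarith [h2.1, Real.pi_pos]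

theorem setIntegral_annulus_eq_polar {m : ℕ} (hm : 1 ≤ m) (e : EuclideanSpace ℝ (Fin (m + 1)))
    (he : ‖e‖ = 1) {f : ℝ → ℝ → ℂ} (hf : Continuous (Function.uncurry f)) :
    ∫ y in {y : EuclideanSpace ℝ (Fin (m + 1)) | 1 ≤ ‖y‖ ∧ ‖y‖ ≤ 2}, f (inner ℝ y e) ‖y‖ =
      (sphereConst m : ℂ) * ∫ θ in (0 : ℝ)..Real.pi, ∫ r in (1 : ℝ)..2,
        ((Real.sin θ ^ (m - 1) * r ^ m : ℝ) : ℂ) * f (r * Real.cos θ) r := by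
  rw [setIntegral_annulus_eq_prod e he f, setIntegral_prod_annulus_eq hm hf,
    setIntegral_halfPlane_eq hm hf]

/-- Integrals of `⟨y, v⟩` against functions of `‖y‖` and `⟨y, e⟩` only see the component of `v`
along the unit vector `e`. -/
theorem setIntegral_inner_mul_eq {d : ℕ} (e v : EuclideanSpace ℝ (Fin d)) (he : ‖e‖ = 1)
    {f : ℝ → ℝ → ℂ} (hf : Continuous (Function.uncurry f)) :
    ∫ y in {y : EuclideanSpace ℝ (Fin d) | 1 ≤ ‖y‖ ∧ ‖y‖ ≤ 2},
        (inner ℝ y v : ℂ) * f (inner ℝ y e) ‖y‖ =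
      (inner ℝ v e : ℂ) * ∫ y in {y : EuclideanSpace ℝ (Fin d) | 1 ≤ ‖y‖ ∧ ‖y‖ ≤ 2},
        (inner ℝ y e : ℂ) * f (inner ℝ y e) ‖y‖ := by
  set w := v - (inner ℝ v e : ℝ) • e with hw
  have hwe : inner ℝ w e = 0 := by
    rw [hw, inner_sub_left, real_inner_smul_left, real_inner_self_eq_norm_sq, he]
    ring
  have hcf : ∀ u : EuclideanSpace ℝ (Fin d), Continuous fun y : EuclideanSpace ℝ (Fin d) =>
      (inner ℝ y u : ℂ) * f (inner ℝ y e) ‖y‖ := fun u => by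
    have h1 : Continuous fun y : EuclideanSpace ℝ (Fin d) =>
      Function.uncurry f (inner ℝ y e, ‖y‖) := hf.comp (by fun_prop)
    exact (Complex.continuous_ofReal.comp (by fun_prop)).mul h1
  have hint := fun u => (hcf u).continuousOn.integrableOn_compact (μ := volume)
    (isCompact_annulus (V := EuclideanSpace ℝ (Fin d)))
  -- The reflection in `w⊥` preserves the annulus, `|y|` and `⟨y, e⟩`, but changes the sign of `⟨y,
  -- w⟩`; the integral equals its negative.
  have hodd : ∫ y in {y : EuclideanSpace ℝ (Fin d) | 1 ≤ ‖y‖ ∧ ‖y‖ ≤ 2},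
      (inner ℝ y w : ℂ) * f (inner ℝ y e) ‖y‖ = 0 := by
    let ρ := Submodule.reflection (Submodule.span ℝ {w})ᗮ
    have hρw : ρ w = -w := Submodule.reflection_mem_subspace_orthogonal_precomplement_eq_neg
      (Submodule.mem_span_singleton_self w)
    have hρe : ρ e = e := Submodule.reflection_mem_subspace_eq_self
      (Submodule.mem_orthogonal_singleton_iff_inner_right.2 hwe)
    have hie : ∀ y, inner ℝ (ρ y) e = inner ℝ y e := fun y => by
      conv_lhs => rw [← hρe]
      exact ρ.inner_map_map y e
    have hiw : ∀ y, inner ℝ (ρ y) w = -inner ℝ y w := fun y => by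
      rw [← ρ.inner_map_map y w, hρw, inner_neg_right, neg_neg]
    have := ρ.measurePreserving.setIntegral_preimage_emb ρ.toHomeomorph.measurableEmbedding
      (fun y => (inner ℝ y w : ℂ) * f (inner ℝ y e) ‖y‖) {y | 1 ≤ ‖y‖ ∧ ‖y‖ ≤ 2}
    simp only [preimage_ofPred_eq, LinearIsometryEquiv.norm_map, hie, hiw, Complex.ofReal_neg,
      neg_mul, integral_neg] at this
    exact self_eq_neg.1 this.symm
  have hsplit : ∀ y : EuclideanSpace ℝ (Fin d), (inner ℝ y v : ℂ) * f (inner ℝ y e) ‖y‖ =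
      (inner ℝ v e : ℂ) * ((inner ℝ y e : ℂ) * f (inner ℝ y e) ‖y‖) +
        (inner ℝ y w : ℂ) * f (inner ℝ y e) ‖y‖ := fun y => by
    rw [hw, inner_sub_right, real_inner_smul_right]
    push_cast
    ring
  simp only [hsplit]
  rw [integral_add ((hint e).const_mul _) (hint w), hodd, add_zero, integral_const_mul]

/-! ### Uniform convexity of the rescaled profiles. -/

theorem dyadic_pos (j : ℕ) : 0 < dyadic j := zpow_pos two_pos _

/-- The rescaled profile on `[1, 2]`, extended by constants to a continuous function. -/
noncomputable def rescaledExtend (γ : ℝ → ℝ) (j : ℕ) (s : ℝ) : ℝ := rescaled γ j (max 1 (min s 2))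

theorem rescaledExtend_eq (γ : ℝ → ℝ) (j : ℕ) {s : ℝ} (hs : s ∈ Icc (1 : ℝ) 2) :
    rescaledExtend γ j s = rescaled γ j s := by
  rw [rescaledExtend, min_eq_left hs.2, max_eq_right hs.1]

namespace IsProfile

variable {R : ℝ} {γ : ℝ → ℝ}

theorem contDiffOn_derivWithin (h : IsProfile R γ) (hR : 0 < R) :
    ContDiffOn ℝ 1 (derivWithin γ (Icc 0 R)) (Icc 0 R) :=
  h.contDiffOn.derivWithin (uniqueDiffOn_Icc hR) (by norm_num)

theorem iteratedDerivWithin_two_eq (x : ℝ) :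
    iteratedDerivWithin 2 γ (Icc 0 R) x =
      derivWithin (derivWithin γ (Icc 0 R)) (Icc 0 R) x := by
  rw [show (2 : ℕ) = 1 + 1 from rfl, iteratedDerivWithin_succ, iteratedDerivWithin_one]

theorem continuousOn_iteratedDerivWithin_two (h : IsProfile R γ) (hR : 0 < R) :
    ContinuousOn (iteratedDerivWithin 2 γ (Icc 0 R)) (Icc 0 R) :=
  h.contDiffOn.continuousOn_iteratedDerivWithin le_rfl (uniqueDiffOn_Icc hR)

theorem hasDerivAt (h : IsProfile R γ) {x : ℝ} (hx : x ∈ Ioo 0 R) :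
    HasDerivAt γ (derivWithin γ (Icc 0 R) x) x :=
  ((h.contDiffOn.differentiableOn (by norm_num)) x (Ioo_subset_Icc_self hx)).hasDerivWithinAt.hasDerivAt
    (Icc_mem_nhds hx.1 hx.2)

theorem hasDerivAt_derivWithin (h : IsProfile R γ) {x : ℝ} (hx : x ∈ Ioo 0 R) :
    HasDerivAt (derivWithin γ (Icc 0 R)) (iteratedDerivWithin 2 γ (Icc 0 R) x) x := by
  rw [iteratedDerivWithin_two_eq]
  exact (((h.contDiffOn_derivWithin (hx.1.trans hx.2)).differentiableOn (by norm_num)) x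
    (Ioo_subset_Icc_self hx)).hasDerivWithinAt.hasDerivAt (Icc_mem_nhds hx.1 hx.2)

theorem monotoneOn_derivWithin (h : IsProfile R γ) :
    MonotoneOn (derivWithin γ (Icc 0 R)) (Icc 0 R) :=
  h.convexOn.monotoneOn_derivWithin (h.contDiffOn.differentiableOn (by norm_num))

theorem iteratedDerivWithin_two_nonneg (h : IsProfile R γ) (x : ℝ) :
    0 ≤ iteratedDerivWithin 2 γ (Icc 0 R) x := by
  rw [iteratedDerivWithin_two_eq]
  exact h.monotoneOn_derivWithin.derivWithin_nonneg

/-- This is the only place where the monotonicity of `γ''` enters. -/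
theorem convexOn_derivWithin (h : IsProfile R γ) (hR : 0 < R) :
    ConvexOn ℝ (Icc 0 R) (derivWithin γ (Icc 0 R)) := by
  have hd : ∀ x ∈ Ioo 0 R, deriv (derivWithin γ (Icc 0 R)) x =
      iteratedDerivWithin 2 γ (Icc 0 R) x := fun x hx => (h.hasDerivAt_derivWithin hx).deriv
  refine MonotoneOn.convexOn_of_deriv (convex_Icc 0 R)
    (h.contDiffOn_derivWithin hR).continuousOn ?_ ?_
  · rw [interior_Icc]
    exact fun x hx => (h.hasDerivAt_derivWithin hx).differentiableAt.differentiableWithinAt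
  · rw [interior_Icc]
    intro x hx y hy hxy
    rw [hd x hx, hd y hy]
    exact h.monotoneOn_deriv2 (Ioo_subset_Icc_self hx) (Ioo_subset_Icc_self hy) hxy

theorem pos (h : IsProfile R γ) {x : ℝ} (hx : 0 < x) (hxR : x ≤ R) : 0 < γ x := by
  have := h.strictMonoOn ⟨le_rfl, hx.le.trans hxR⟩ ⟨hx.le, hxR⟩ hx
  rwa [h.map_zero] at this

/-- Convexity of `γ'` together with `γ'(0) = 0`. -/
theorem mul_sub_le_mul_sub (h : IsProfile R γ) {x y : ℝ} (hx : 0 < x) (hxy : x ≤ y)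
    (hy : y ≤ R) : derivWithin γ (Icc 0 R) x * (y - x) ≤
      x * (derivWithin γ (Icc 0 R) y - derivWithin γ (Icc 0 R) x) := by
  rcases hxy.eq_or_lt with rfl | hlt
  · simp
  have hR : 0 < R := hx.trans_le (hxy.trans hy)
  have := (h.convexOn_derivWithin hR).slope_mono_adjacent (x := 0) (y := x) (z := y)
    ⟨le_rfl, hR.le⟩ ⟨hx.le.trans hxy, hy⟩ hx hlt
  rw [h.deriv_zero, sub_zero, sub_zero, div_le_div_iff₀ hx (sub_pos.2 hlt)] at this
  linarith

/-- Mean value theorem on `[0, x]` and monotonicity of `γ'`. At `x = 2^{-j}` it says `γ_j'(1) ≥ 1`.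
-/
theorem le_mul_derivWithin (h : IsProfile R γ) {x : ℝ} (hx : 0 < x) (hxR : x ≤ R) :
    γ x ≤ x * derivWithin γ (Icc 0 R) x := by
  obtain ⟨c, hc, hce⟩ := exists_hasDerivAt_eq_slope γ (derivWithin γ (Icc 0 R)) hx
    (h.contDiffOn.continuousOn.mono (Icc_subset_Icc_right hxR))
    fun y hy => h.hasDerivAt ⟨hy.1, hy.2.trans_le hxR⟩
  rw [h.map_zero, sub_zero, sub_zero, eq_div_iff hx.ne'] at hce
  have := h.monotoneOn_derivWithin ⟨hc.1.le, hc.2.le.trans hxR⟩ ⟨hx.le, hxR⟩ hc.2.le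
  nlinarith

theorem continuous_rescaledExtend (h : IsProfile R γ) {j : ℕ} (hj : 2 * dyadic j ≤ R) :
    Continuous (rescaledExtend γ j) := by
  have hδ := dyadic_pos j
  have h1 : ContinuousOn (rescaled γ j) (Icc 1 2) := by
    refine ContinuousOn.div_const (h.contDiffOn.continuousOn.comp (by fun_prop) ?_) _
    intro s hs
    exact ⟨by nlinarith [hs.1], by nlinarith [hs.2]⟩
  exact h1.comp_continuous (by fun_prop) fun s =>
    ⟨le_max_left _ _, max_le one_le_two (min_le_right _ _)⟩

/-- The rescaled profiles are convex phases, uniformly in all parameters. -/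
theorem isConvexPhase (h : IsProfile R γ) {j : ℕ} (hj : 2 * dyadic j ≤ R) :
    IsConvexPhase (rescaledExtend γ j)
      (fun s => dyadic j * derivWithin γ (Icc 0 R) (dyadic j * s) / γ (dyadic j))
      (fun s => dyadic j * (dyadic j * iteratedDerivWithin 2 γ (Icc 0 R) (dyadic j * s)) /
        γ (dyadic j)) := by
  have hδ := dyadic_pos j
  have hR : 0 < R := by linarith
  have hγ : 0 < γ (dyadic j) := h.pos hδ (by linarith)
  have hmaps : MapsTo (fun s => dyadic j * s) (Icc 1 2) (Icc 0 R) := fun s hs =>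
    ⟨by nlinarith [hs.1], by nlinarith [hs.2]⟩
  have hmapsO : ∀ s ∈ Ioo (1 : ℝ) 2, dyadic j * s ∈ Ioo 0 R := fun s hs =>
    ⟨by nlinarith [hs.1], by nlinarith [hs.2]⟩
  have hlin : ∀ s, HasDerivAt (fun s => dyadic j * s) (dyadic j) s := fun s => by
    simpa using (hasDerivAt_id' s).const_mul (dyadic j)
  have hmul : ∀ x ∈ Icc (1 : ℝ) 2, ∀ y ∈ Icc (1 : ℝ) 2, x ≤ y →
      dyadic j * derivWithin γ (Icc 0 R) (dyadic j * x) / γ (dyadic j) * (y - x) ≤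
      x * (dyadic j * derivWithin γ (Icc 0 R) (dyadic j * y) / γ (dyadic j) -
        dyadic j * derivWithin γ (Icc 0 R) (dyadic j * x) / γ (dyadic j)) := by
    intro x hx y hy hxy
    have hx0 : 0 < dyadic j * x := by nlinarith [hx.1]
    have := h.mul_sub_le_mul_sub hx0 (mul_le_mul_of_nonneg_left hxy hδ.le) (hmaps hy).2
    have h2 := mul_le_mul_of_nonneg_right this (inv_nonneg.2 hγ.le)
    calc _ = derivWithin γ (Icc 0 R) (dyadic j * x) * (dyadic j * y - dyadic j * x) *
          (γ (dyadic j))⁻¹ := by ring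
      _ ≤ _ := h2
      _ = _ := by ring
  have hmono : ∀ x ∈ Icc (1 : ℝ) 2, ∀ y ∈ Icc (1 : ℝ) 2, x ≤ y →
      dyadic j * derivWithin γ (Icc 0 R) (dyadic j * x) / γ (dyadic j) ≤
      dyadic j * derivWithin γ (Icc 0 R) (dyadic j * y) / γ (dyadic j) := by
    intro x hx y hy hxy
    have := h.monotoneOn_derivWithin (hmaps hx) (hmaps hy) (mul_le_mul_of_nonneg_left hxy hδ.le)
    gcongr
  refine ⟨h.continuous_rescaledExtend hj, ?_, ?_, fun s hs => ?_, fun s hs => ?_, fun s hs => ?_,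
    fun s hs => ?_, fun x hx y hy hxy => ?_⟩
  · exact (continuousOn_const.mul ((h.contDiffOn_derivWithin hR).continuousOn.comp
      (by fun_prop) hmaps)).div_const _
  · exact (continuousOn_const.mul (continuousOn_const.mul
      ((h.continuousOn_iteratedDerivWithin_two hR).comp (by fun_prop) hmaps))).div_const _
  · have h1 := ((h.hasDerivAt (hmapsO s hs)).comp s (hlin s)).div_const (γ (dyadic j))
    rw [mul_comm (dyadic j) (derivWithin _ _ _)]
    refine h1.congr_of_eventuallyEq ?_
    filter_upwards [Icc_mem_nhds hs.1 hs.2] with t ht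
    rw [rescaledExtend_eq γ j ht]
    rfl
  · have h1 := (((h.hasDerivAt_derivWithin (hmapsO s hs)).comp s (hlin s)).const_mul
      (dyadic j)).div_const (γ (dyadic j))
    rw [mul_comm (dyadic j) (iteratedDerivWithin _ _ _ _)]
    exact h1
  · have := h.iteratedDerivWithin_two_nonneg (dyadic j * s)
    positivity
  · have h1m : (1 : ℝ) ∈ Icc (1 : ℝ) 2 := left_mem_Icc.2 one_le_two
    refine le_trans ?_ (hmono 1 h1m s hs hs.1)
    rw [mul_one, le_div_iff₀ hγ, one_mul]
    exact h.le_mul_derivWithin hδ (by linarith)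
  -- The factor `2` in `IsConvexPhase` is the upper bound of `x` on `[1, 2]`.
  · refine (hmul x hx y hy hxy).trans ?_
    exact mul_le_mul_of_nonneg_right hx.2 (sub_nonneg.2 (hmono x hx y hy hxy))

end IsProfile

/-! ### Decay of annular integrals with radial or linear amplitude. -/

/-- With `b = 1/γ(2^{-j})` this is the factor produced by `∂/∂ξ_n`. It increases because `p ≥ 1`, so
its sign need only be checked at `r = 1`. -/
theorem IsConvexPhase.isAmplitude_add {g p q : ℝ → ℝ} (h : IsConvexPhase g p q) {b : ℝ}
    (hb : 0 ≤ b + g 1) : IsAmplitude (fun r => g r + b) p where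
  continuous := h.continuous.add continuous_const
  continuousOn_deriv := h.continuousOn_deriv
  hasDerivAt x hx := (h.hasDerivAt x hx).add_const b
  nonneg x hx := by
    have : MonotoneOn g (Icc 1 2) :=
      monotoneOn_of_deriv_nonneg (convex_Icc 1 2) h.continuous.continuousOn
        (fun y hy => ((h.hasDerivAt y (by simpa using hy)).differentiableAt).differentiableWithinAt)
        fun y hy => by
          rw [interior_Icc] at hy
          rw [(h.hasDerivAt y hy).deriv]
          exact zero_le_one.trans (h.one_le_deriv y (Ioo_subset_Icc_self hy))
    linarith [this (left_mem_Icc.2 one_le_two) hx hx.1]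
  deriv_nonneg x hx := zero_le_one.trans (h.one_le_deriv x hx)

theorem isAmplitude_one : IsAmplitude (fun _ => 1) fun _ => 0 where
  continuous := continuous_const
  continuousOn_deriv := continuousOn_const
  hasDerivAt x _ := hasDerivAt_const x 1
  nonneg _ _ := zero_le_one
  deriv_nonneg _ _ := le_rfl

theorem hasDerivAt_sin_pow_mul_cos_pow (k l : ℕ) (θ : ℝ) :
    HasDerivAt (fun θ => Real.sin θ ^ k * Real.cos θ ^ l)
      (k * Real.sin θ ^ (k - 1) * Real.cos θ * Real.cos θ ^ l +
        Real.sin θ ^ k * (l * Real.cos θ ^ (l - 1) * -Real.sin θ)) θ :=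
  ((Real.hasDerivAt_sin θ).pow k).mul ((Real.hasDerivAt_cos θ).pow l)

theorem abs_sin_pow_mul_cos_pow_le (k l : ℕ) (θ : ℝ) :
    |Real.sin θ ^ k * Real.cos θ ^ l| ≤ 1 := by
  rw [abs_mul, abs_pow, abs_pow]
  exact mul_le_one₀ (pow_le_one₀ (abs_nonneg _) (Real.abs_sin_le_one θ)) (by positivity)
    (pow_le_one₀ (abs_nonneg _) (Real.abs_cos_le_one θ))

theorem abs_deriv_sin_pow_mul_cos_pow_le (k l : ℕ) (θ : ℝ) :
    |k * Real.sin θ ^ (k - 1) * Real.cos θ * Real.cos θ ^ l +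
        Real.sin θ ^ k * (l * Real.cos θ ^ (l - 1) * -Real.sin θ)| ≤ (k : ℝ) + l := by
  have h1 := abs_sin_pow_mul_cos_pow_le (k - 1) (l + 1) θ
  have h2 := abs_sin_pow_mul_cos_pow_le (k + 1) (l - 1) θ
  have hk : (0 : ℝ) ≤ k := k.cast_nonneg
  have hl : (0 : ℝ) ≤ l := l.cast_nonneg
  calc _ = |k * (Real.sin θ ^ (k - 1) * Real.cos θ ^ (l + 1)) +
        -(l * (Real.sin θ ^ (k + 1) * Real.cos θ ^ (l - 1)))| := by congr 1; ring
    _ ≤ _ := (abs_add_le _ _).trans <| by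
      rw [abs_neg, abs_mul (k : ℝ), abs_mul (l : ℝ), abs_of_nonneg hk, abs_of_nonneg hl]
      exact add_le_add (mul_le_of_le_one_right hk h1) (mul_le_of_le_one_right hl h2)

/-- The constant in the bound for annular oscillatory integrals with a factor `⟨y, e⟩^l`. -/
noncomputable def annularConst (m l : ℕ) : ℝ := sphereConst m * (2 ^ (m + l) * (1472 + 608 * ((m : ℝ) + l)))

theorem annularConst_nonneg (m l : ℕ) : 0 ≤ annularConst m l := by
  unfold annularConst sphereConst
  positivity

/-- In polar coordinates about `e` the factor `⟨y, e⟩^l` is `r^l cos^l θ`. The angular weight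
becomes `sin^{m-1} θ cos^l θ` and the radial power `m + l ≥ 1`, which leaves the power of `r`
consumed by the integration by parts in `θ`. -/
theorem norm_setIntegral_inner_pow_le {m : ℕ} (hm : 1 ≤ m) {a a' g p q : ℝ → ℝ}
    (ha : IsAmplitude a a') (hg : IsConvexPhase g p q) (e : EuclideanSpace ℝ (Fin (m + 1)))
    (he : ‖e‖ = 1) (l : ℕ) {A : ℝ} (hA : 0 ≤ A) (B : ℝ) :
    ‖∫ y in {y : EuclideanSpace ℝ (Fin (m + 1)) | 1 ≤ ‖y‖ ∧ ‖y‖ ≤ 2},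
        ((inner ℝ y e ^ l * a ‖y‖ : ℝ) : ℂ) *
          Complex.exp (Complex.I * ((A * inner ℝ y e + B * g ‖y‖ : ℝ) : ℂ))‖ ≤
      annularConst m l * a 2 / (1 + A + |B|) := by
  have hac := ha.continuous
  have hgc := hg.continuous
  obtain ⟨k, rfl⟩ := Nat.exists_eq_add_of_le' hm
  have hpol := setIntegral_annulus_eq_polar hm e he (f := fun t r => ((t ^ l * a r : ℝ) : ℂ) *
    Complex.exp (Complex.I * ((A * t + B * g r : ℝ) : ℂ))) (by unfold Function.uncurry; fun_prop)
  have hrad : ∀ θ : ℝ, ∫ r in (1 : ℝ)..2, ((Real.sin θ ^ (k + 1 - 1) * r ^ (k + 1) : ℝ) : ℂ) *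
      ((((r * Real.cos θ) ^ l * a r : ℝ) : ℂ) *
        Complex.exp (Complex.I * ((A * (r * Real.cos θ) + B * g r : ℝ) : ℂ))) =
      ((Real.sin θ ^ k * Real.cos θ ^ l : ℝ) : ℂ) * radialOsc a g A B (k + l + 1) θ := fun θ => by
    rw [radialOsc, ← intervalIntegral.integral_const_mul]
    refine intervalIntegral.integral_congr fun r _ => ?_
    rw [show A * (r * Real.cos θ) = A * Real.cos θ * r by ring, add_tsub_cancel_right]
    push_cast
    ring
  simp only [hrad] at hpol
  rw [hpol, norm_mul, Complex.norm_real, Real.norm_eq_abs,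
    abs_of_nonneg (by unfold sphereConst; positivity)]
  -- The derivative of the weight is at most `k + l`; the larger `W = m + l` keeps the constant in
  -- terms of `m`.
  have hmain := norm_integral_radialOsc_le ha hg (hasDerivAt_sin_pow_mul_cos_pow k l)
    (by fun_prop) (abs_sin_pow_mul_cos_pow_le k l) (W := ((k + 1 : ℕ) : ℝ) + l)
    (fun θ => (abs_deriv_sin_pow_mul_cos_pow_le k l θ).trans (by push_cast; linarith)) hA B (k + l)
  refine (mul_le_mul_of_nonneg_left hmain (by unfold sphereConst; positivity)).trans
    (le_of_eq ?_)
  rw [annularConst, show k + 1 + l = k + l + 1 by ring]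
  ring

theorem exists_norm_eq_one_smul_eq {m : ℕ} (η : EuclideanSpace ℝ (Fin (m + 1))) :
    ∃ e : EuclideanSpace ℝ (Fin (m + 1)), ‖e‖ = 1 ∧ ‖η‖ • e = η := by
  by_cases h : η = 0
  · exact ⟨EuclideanSpace.single 0 1, by simp, by simp [h]⟩
  · exact ⟨‖η‖⁻¹ • η, norm_smul_inv_norm h, smul_inv_smul₀ (norm_ne_zero_iff.2 h) η⟩

/-- Decay of annular oscillatory integrals with a radial amplitude. -/
theorem norm_setIntegral_annulus_le {m : ℕ} (hm : 1 ≤ m) {a a' g p q : ℝ → ℝ}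
    (ha : IsAmplitude a a') (hg : IsConvexPhase g p q) (η : EuclideanSpace ℝ (Fin (m + 1)))
    (B : ℝ) :
    ‖∫ y in {y : EuclideanSpace ℝ (Fin (m + 1)) | 1 ≤ ‖y‖ ∧ ‖y‖ ≤ 2}, (a ‖y‖ : ℂ) *
          Complex.exp (Complex.I * ((inner ℝ y η + B * g ‖y‖ : ℝ) : ℂ))‖ ≤
      annularConst m 0 * a 2 / (1 + ‖η‖ + |B|) := by
  obtain ⟨e, he, hη⟩ := exists_norm_eq_one_smul_eq η
  have := norm_setIntegral_inner_pow_le hm ha hg e he 0 (norm_nonneg η) B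
  simpa only [pow_zero, one_mul, ← real_inner_smul_right, hη] using this

/-- Decay of annular oscillatory integrals with a linear amplitude. -/
theorem norm_setIntegral_inner_mul_le {m : ℕ} (hm : 1 ≤ m) {g p q : ℝ → ℝ}
    (hg : IsConvexPhase g p q) (η v : EuclideanSpace ℝ (Fin (m + 1))) (B : ℝ) :
    ‖∫ y in {y : EuclideanSpace ℝ (Fin (m + 1)) | 1 ≤ ‖y‖ ∧ ‖y‖ ≤ 2}, (inner ℝ y v : ℂ) *
          Complex.exp (Complex.I * ((inner ℝ y η + B * g ‖y‖ : ℝ) : ℂ))‖ ≤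
      ‖v‖ * (annularConst m 1 / (1 + ‖η‖ + |B|)) := by
  obtain ⟨e, he, hη⟩ := exists_norm_eq_one_smul_eq η
  have hgc := hg.continuous
  have h1 := norm_setIntegral_inner_pow_le hm isAmplitude_one hg e he 1 (norm_nonneg η) B
  have h2 := setIntegral_inner_mul_eq e v he (f := fun t r =>
    Complex.exp (Complex.I * ((‖η‖ * t + B * g r : ℝ) : ℂ))) (by unfold Function.uncurry; fun_prop)
  simp only [pow_one, mul_one] at h1
  simp only [← real_inner_smul_right, hη] at h1 h2
  rw [h2, norm_mul, Complex.norm_real]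
  refine mul_le_mul ?_ h1 (norm_nonneg _) (norm_nonneg _)
  simpa [he] using norm_inner_le_norm (𝕜 := ℝ) v e

/-! ### Differentiation under the integral and the final estimates. -/

/-- Differentiation of an oscillatory integral with linear phase over a compact set. -/
theorem differentiableAt_setIntegral_exp_inner {V W : Type*} [NormedAddCommGroup V]
    [MeasurableSpace V] [BorelSpace V] [SecondCountableTopology V] {μ : Measure V}
    [IsFiniteMeasureOnCompacts μ]
    [NormedAddCommGroup W] [InnerProductSpace ℝ W] {Φ : V → W} (hΦ : Continuous Φ) {S : Set V}
    (hS : IsCompact S) (ξ : W) :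
    DifferentiableAt ℝ (fun ξ => ∫ y in S, Complex.exp (Complex.I * (inner ℝ (Φ y) ξ : ℂ)) ∂μ) ξ ∧
    ∀ v, fderiv ℝ (fun ξ => ∫ y in S, Complex.exp (Complex.I * (inner ℝ (Φ y) ξ : ℂ)) ∂μ) ξ v =
      Complex.I * ∫ y in S, (inner ℝ (Φ y) v : ℂ) *
        Complex.exp (Complex.I * (inner ℝ (Φ y) ξ : ℂ)) ∂μ := by
  let F' : W → V → W →L[ℝ] ℂ := fun ξ y =>
    (Complex.I * Complex.exp (Complex.I * (inner ℝ (Φ y) ξ : ℂ))) •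
      (Complex.ofRealCLM.comp (innerSL ℝ (Φ y)))
  have hexp : ∀ ξ, Continuous fun y => Complex.exp (Complex.I * (inner ℝ (Φ y) ξ : ℂ)) :=
    fun ξ => by fun_prop
  have hF'c : Continuous (F' ξ) := by
    refine (continuous_const.mul (hexp ξ)).smul ?_
    exact continuous_const.clm_comp ((innerSL ℝ).continuous.comp hΦ)
  have hint : ∀ {f : V → ℂ}, Continuous f → IntegrableOn f S μ := fun hf =>
    hf.continuousOn.integrableOn_compact hS
  have hF'i : IntegrableOn (F' ξ) S μ := hF'c.continuousOn.integrableOn_compact hS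
  have key := hasFDerivAt_integral_of_dominated_of_fderiv_le (𝕜 := ℝ) (μ := μ.restrict S)
    (s := univ) (x₀ := ξ)
    (F := fun ξ y => Complex.exp (Complex.I * (inner ℝ (Φ y) ξ : ℂ))) (F' := F')
    (bound := fun y => ‖Complex.ofRealCLM.comp (innerSL ℝ (Φ y))‖) Filter.univ_mem
    (Filter.Eventually.of_forall fun ξ => ((hint (hexp ξ)).aestronglyMeasurable))
    (hint (hexp ξ)) hF'i.aestronglyMeasurable
    (Filter.Eventually.of_forall fun y ξ _ => by
      rw [norm_smul, norm_mul, Complex.norm_I, Complex.norm_exp_I_mul_ofReal, one_mul, one_mul])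
    ((continuous_norm.comp (continuous_const.clm_comp
      ((innerSL ℝ).continuous.comp hΦ))).continuousOn.integrableOn_compact hS)
    (Filter.Eventually.of_forall fun y ξ _ => by
      have h1 : HasFDerivAt (fun ξ => (inner ℝ (Φ y) ξ : ℂ))
          (Complex.ofRealCLM.comp (innerSL ℝ (Φ y))) ξ :=
        (Complex.ofRealCLM.comp (innerSL ℝ (Φ y))).hasFDerivAt
      have h2 := (h1.const_mul Complex.I).cexp
      refine h2.congr_fderiv ?_
      rw [smul_smul, mul_comm])
  refine ⟨key.differentiableAt, fun v => ?_⟩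
  rw [key.fderiv, ContinuousLinearMap.integral_apply hF'i, ← integral_const_mul]
  refine integral_congr_ae (Filter.Eventually.of_forall fun y => ?_)
  simp only [F', smul_apply, ContinuousLinearMap.comp_apply, innerSL_apply_apply,
    Complex.ofRealCLM_apply, smul_eq_mul]
  ring

theorem norm_le_norm_firstCoords_add {d : ℕ} (ξ : EuclideanSpace ℝ (Fin (d + 1))) :
    ‖ξ‖ ≤ ‖firstCoords ξ‖ + |ξ (Fin.last d)| := by
  refine abs_le_of_sq_le_sq' ?_ (by positivity) |>.2
  have h : ‖ξ‖ ^ 2 = ‖firstCoords ξ‖ ^ 2 + |ξ (Fin.last d)| ^ 2 := by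
    rw [EuclideanSpace.norm_sq_eq, EuclideanSpace.norm_sq_eq, Fin.sum_univ_castSucc]
    rfl
  rw [h]
  nlinarith [norm_nonneg (firstCoords ξ), abs_nonneg (ξ (Fin.last d))]

theorem norm_le_card_mul {n : ℕ} (x : EuclideanSpace ℂ (Fin n)) {D : ℝ} (hD : ∀ i, ‖x i‖ ≤ D) :
    ‖x‖ ≤ n * D := by
  rcases Nat.eq_zero_or_pos n with rfl | hn
  · simp [EuclideanSpace.norm_eq]
  have hD0 : 0 ≤ D := (norm_nonneg _).trans (hD ⟨0, hn⟩)
  have hn1 : (1 : ℝ) ≤ n := by exact_mod_cast hn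
  refine abs_le_of_sq_le_sq' ?_ (by positivity) |>.2
  rw [EuclideanSpace.norm_sq_eq]
  calc ∑ i, ‖x i‖ ^ 2 ≤ ∑ _i : Fin n, D ^ 2 :=
        Finset.sum_le_sum fun i _ => pow_le_pow_left₀ (norm_nonneg _) (hD i) 2
    _ = n * D ^ 2 := by simp
    _ ≤ (n * D) ^ 2 := by
        rw [mul_pow]
        exact mul_le_mul_of_nonneg_right (by nlinarith) (sq_nonneg D)

/-- The frequency vector `(y, g(|y|) + b)` on the graph of `g`. -/
noncomputable def graphMap {d : ℕ} (g : ℝ → ℝ) (b : ℝ) (y : EuclideanSpace ℝ (Fin d)) :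
    EuclideanSpace ℝ (Fin (d + 1)) :=
  WithLp.toLp 2 (Fin.snoc (α := fun _ => ℝ) y (g ‖y‖ + b))

theorem continuous_graphMap {d : ℕ} {g : ℝ → ℝ} (hg : Continuous g) (b : ℝ) :
    Continuous (graphMap (d := d) g b) := by
  refine (PiLp.continuous_toLp 2 _).comp (continuous_pi fun i => ?_)
  refine Fin.lastCases ?_ (fun i => ?_) i
  · simp only [Fin.snoc_last]
    fun_prop
  · simp only [Fin.snoc_castSucc]
    fun_prop

theorem inner_graphMap {d : ℕ} (g : ℝ → ℝ) (b : ℝ) (y : EuclideanSpace ℝ (Fin d))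
    (ξ : EuclideanSpace ℝ (Fin (d + 1))) :
    inner ℝ (graphMap g b y) ξ = inner ℝ y (firstCoords ξ) + ξ (Fin.last d) * (g ‖y‖ + b) := by
  simp [graphMap, firstCoords, PiLp.inner_apply, Fin.sum_univ_castSucc]

theorem exp_inner_graphMap {d : ℕ} (g : ℝ → ℝ) (b : ℝ) (y : EuclideanSpace ℝ (Fin d))
    (ξ : EuclideanSpace ℝ (Fin (d + 1))) :
    Complex.exp (Complex.I * (inner ℝ (graphMap g b y) ξ : ℂ)) =
      Complex.exp (Complex.I * ((ξ (Fin.last d) * b : ℝ) : ℂ)) * Complex.exp (Complex.I *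
        ((inner ℝ y (firstCoords ξ) + ξ (Fin.last d) * g ‖y‖ : ℝ) : ℂ)) := by
  rw [inner_graphMap, ← Complex.exp_add]
  congr 1
  push_cast
  ring

theorem annularFT_eq_setIntegral (d : ℕ) (γ : ℝ → ℝ) (j : ℕ) :
    annularFT d γ j = fun ξ => ∫ y in {y : EuclideanSpace ℝ (Fin d) | 1 ≤ ‖y‖ ∧ ‖y‖ ≤ 2},
      Complex.exp (Complex.I *
        (inner ℝ (graphMap (rescaledExtend γ j) (γ (dyadic j))⁻¹ y) ξ : ℂ)) := by
  ext ξ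
  refine setIntegral_congr_fun isCompact_annulus.measurableSet fun y hy => ?_
  simp only
  rw [exp_inner_graphMap, rescaledExtend_eq γ j hy, mul_comm, div_eq_mul_inv]

/-- A weighted integral of `e^{i⟨Φ(y), ξ⟩}` loses only a unimodular factor. -/
theorem norm_setIntegral_mul_exp_inner_graphMap {d : ℕ} (g : ℝ → ℝ) (b : ℝ)
    (S : Set (EuclideanSpace ℝ (Fin d))) (h : EuclideanSpace ℝ (Fin d) → ℂ)
    (ξ : EuclideanSpace ℝ (Fin (d + 1))) :
    ‖∫ y in S, h y * Complex.exp (Complex.I * (inner ℝ (graphMap g b y) ξ : ℂ))‖ =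
      ‖∫ y in S, h y * Complex.exp (Complex.I *
        ((inner ℝ y (firstCoords ξ) + ξ (Fin.last d) * g ‖y‖ : ℝ) : ℂ))‖ := by
  simp only [exp_inner_graphMap, mul_left_comm (h _)]
  rw [integral_const_mul, norm_mul, Complex.norm_exp_I_mul_ofReal, one_mul]

theorem div_one_add_norm_le {d : ℕ} {C : ℝ} (hC : 0 ≤ C) (ξ : EuclideanSpace ℝ (Fin (d + 1))) :
    C / (1 + ‖firstCoords ξ‖ + |ξ (Fin.last d)|) ≤ C * (1 + ‖ξ‖)⁻¹ := by
  rw [← div_eq_mul_inv]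
  have := norm_le_norm_firstCoords_add ξ
  exact div_le_div_of_nonneg_left hC (by positivity) (by linarith)

theorem lemma5 (d : ℕ) (hd : 3 ≤ d + 1) :
    (∃ C : ℝ, ∀ (R : ℝ) (γ : ℝ → ℝ), IsProfile R γ → ∀ j : ℕ, 2 * dyadic j ≤ R →
      ∀ ξ : EuclideanSpace ℝ (Fin (d + 1)),
        ‖annularFT d γ j ξ‖ ≤ C * (1 + ‖ξ‖)⁻¹) ∧
    (∀ K : ℝ, ∃ C : ℝ, ∀ (R : ℝ) (γ : ℝ → ℝ), IsProfile R γ → ∀ j : ℕ, 2 * dyadic j ≤ R →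
      γ (2 * dyadic j) ≤ K →
      ∀ ξ : EuclideanSpace ℝ (Fin (d + 1)),
        DifferentiableAt ℝ (annularFT d γ j) ξ ∧
        ‖cgrad (annularFT d γ j) ξ‖ ≤ C / γ (dyadic j) * (1 + ‖ξ‖)⁻¹) := by
  obtain ⟨m, rfl⟩ : ∃ m, d = m + 1 := ⟨d - 1, by omega⟩
  have hm : 1 ≤ m := by omega
  -- The gradient has `n = m + 2` components. Those along `ξ'` account for the term with `K`, the
  -- last one for the term with `K + 1`; each is bounded by the sum.
  refine ⟨⟨annularConst m 0, fun R γ h j hj ξ => ?_⟩, fun K =>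
    ⟨((m + 1 + 1 : ℕ) : ℝ) * (annularConst m 1 * K + annularConst m 0 * (K + 1)),
      fun R γ h j hj hK ξ => ?_⟩⟩
  · have h1 := norm_setIntegral_annulus_le hm isAmplitude_one (h.isConvexPhase hj)
      (firstCoords ξ) (ξ (Fin.last (m + 1)))
    have h2 := norm_setIntegral_mul_exp_inner_graphMap (rescaledExtend γ j) (γ (dyadic j))⁻¹
      {y : EuclideanSpace ℝ (Fin (m + 1)) | 1 ≤ ‖y‖ ∧ ‖y‖ ≤ 2} (fun _ => 1) ξ
    simp only [Complex.ofReal_one, one_mul, mul_one] at h1 h2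
    rw [annularFT_eq_setIntegral]
    exact (h2.trans_le h1).trans (div_one_add_norm_le (annularConst_nonneg m 0) ξ)
  · have hδ := dyadic_pos j
    have hγ : 0 < γ (dyadic j) := h.pos hδ (by linarith)
    have hγ2 : 0 < γ (2 * dyadic j) := h.pos (by linarith) hj
    have hγK : γ (dyadic j) ≤ K := (h.strictMonoOn.monotoneOn ⟨hδ.le, by linarith⟩
      ⟨by linarith, hj⟩ (by linarith)).trans hK
    have hK0 : 0 < K := hγ2.trans_le hK
    have hc0 := annularConst_nonneg m 0
    have hc1 := annularConst_nonneg m 1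
    have hphase := h.isConvexPhase hj
    obtain ⟨hdiff, hfd⟩ := differentiableAt_setIntegral_exp_inner (μ := volume)
      (continuous_graphMap (d := m + 1) hphase.continuous (γ (dyadic j))⁻¹)
      isCompact_annulus ξ
    have hb : 0 ≤ (γ (dyadic j))⁻¹ + rescaledExtend γ j 1 := by
      rw [rescaledExtend_eq γ j (left_mem_Icc.2 one_le_two), rescaled, mul_one]
      positivity
    have hamp := hphase.isAmplitude_add hb
    -- The amplitude at `|y| = 2` is `(γ(2^{1-j}) + 1)/γ(2^{-j})`, and here `γ(2^{1-j}) ≤ K` is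
    -- used.
    have hamp2 : rescaledExtend γ j 2 + (γ (dyadic j))⁻¹ ≤ (K + 1) / γ (dyadic j) := by
      rw [rescaledExtend_eq γ j (right_mem_Icc.2 one_le_two), rescaled, mul_comm, inv_eq_one_div,
        ← add_div]
      gcongr
    have hinv : 0 < (1 + ‖ξ‖)⁻¹ := by positivity
    rw [annularFT_eq_setIntegral]
    refine ⟨hdiff, (norm_le_card_mul _ (D := (annularConst m 1 * K + annularConst m 0 * (K + 1)) /
      γ (dyadic j) * (1 + ‖ξ‖)⁻¹) fun i => ?_).trans (le_of_eq (by ring))⟩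
    simp only [cgrad]
    rw [hfd, norm_mul, Complex.norm_I, one_mul, norm_setIntegral_mul_exp_inner_graphMap]
    have hsplit : (annularConst m 1 * K + annularConst m 0 * (K + 1)) /
      γ (dyadic j) * (1 + ‖ξ‖)⁻¹ = annularConst m 1 * (K / γ (dyadic j)) * (1 + ‖ξ‖)⁻¹ +
        annularConst m 0 * ((K + 1) / γ (dyadic j)) * (1 + ‖ξ‖)⁻¹ := by ring
    have hp1 : 0 ≤ annularConst m 1 * (K / γ (dyadic j)) * (1 + ‖ξ‖)⁻¹ := by positivity
    have hp0 : 0 ≤ annularConst m 0 * ((K + 1) / γ (dyadic j)) * (1 + ‖ξ‖)⁻¹ := by positivity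
    rw [hsplit]
    refine Fin.lastCases ?_ (fun i => ?_) i
    · have hin : ∀ y : EuclideanSpace ℝ (Fin (m + 1)),
          inner ℝ (graphMap (rescaledExtend γ j) (γ (dyadic j))⁻¹ y)
            (EuclideanSpace.single (Fin.last (m + 1)) (1 : ℝ)) =
          rescaledExtend γ j ‖y‖ + (γ (dyadic j))⁻¹ := fun y => by
        rw [EuclideanSpace.inner_single_right]
        simp [graphMap]
      simp only [hin]
      refine (norm_setIntegral_annulus_le hm hamp hphase (firstCoords ξ)
        (ξ (Fin.last (m + 1)))).trans ?_
      have ha0 := hamp.nonneg 2 (right_mem_Icc.2 one_le_two)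
      refine (div_one_add_norm_le (mul_nonneg hc0 ha0) ξ).trans ?_
      have := mul_le_mul_of_nonneg_right (mul_le_mul_of_nonneg_left hamp2 hc0) hinv.le
      linarith
    · have hin : ∀ y : EuclideanSpace ℝ (Fin (m + 1)),
          inner ℝ (graphMap (rescaledExtend γ j) (γ (dyadic j))⁻¹ y)
            (EuclideanSpace.single i.castSucc (1 : ℝ)) =
          inner ℝ y (EuclideanSpace.single i (1 : ℝ)) := fun y => by
        rw [EuclideanSpace.inner_single_right, EuclideanSpace.inner_single_right]
        simp [graphMap]
      simp only [hin]
      refine (norm_setIntegral_inner_mul_le hm hphase (firstCoords ξ)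
        (EuclideanSpace.single i (1 : ℝ)) (ξ (Fin.last (m + 1)))).trans ?_
      rw [PiLp.norm_single, norm_one, one_mul]
      refine (div_one_add_norm_le hc1 ξ).trans ?_
      -- Derivatives along `ξ'` lose no factor `1/γ(2^{-j})`; `γ(2^{-j}) ≤ K` puts their bound in
      -- the common form.
      have h1K : 1 ≤ K / γ (dyadic j) := (one_le_div hγ).2 hγK
      have := mul_le_mul_of_nonneg_right (le_mul_of_one_le_right hc1 h1K) hinv.le
      linarith
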